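/- Let $\mathbf a_1,\dots,\mathbf a_m\in\mathbb R^n$ and $b_1,\dots,b_m\in\mathbb R$, and let $$P=\{\mathbf x\in\mathbb R^n:\ \langle \mathbf a_i,\mathbf x\rangle+b_i\ge 0\ \text{ for } i=1,\dots,m\}$$ (some of the inequalities may be redundant). Assume that this presentation is * *generic*: $P$ is $n$-dimensional and has at least one vertex, and for every $\mathbf x\in P$ the family of all vectors $\mathbf a_i$ with $\langle\mathbf a_i,\mathbf x\rangle+b_i=0$ is linearly independent; * *rational*: $\Lambda=\mathbb Z\langle\mathbf a_1,\dots,\mathbf a_m\rangle$ is a lattice (a discrete subgroup) in $\mathbb R^n$. Let $$\mathcal R_P=\{\mathbf u\in\mathbb R^m:\ \text{there is } \mathbf x\in P \text{ with } u_i^2=\langle\mathbf a_i,\mathbf x\rangle+b_i \text{ for all } i\},$$ which is a smooth $n$-dimensional submanifold of $\mathbb R^m$. Let $T_P\subset\mathbb T^m=\mathbb R^m/\mathbb Z^m$ be the kernel of the homomorphism $\mathbb R^m/\mathbb Z^m\to\mathbb R^n/\Lambda$, $(\chi_1,\dots,\chi_m)\mapsto\sum_k\chi_k\mathbf a_k$;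 it is an $(m-n)$-dimensional torus, whose elements we write as $\mathbf t=(e^{2\pi i\chi_1},\dots,e^{2\pi i\chi_m})$. Let $D_P=\{\mathbf g\in T_P:\mathbf g^2=1\}\cong(\mathbb Z/2)^{m-n}$. The finite group $D_P$ acts on $\mathcal R_P$ by coordinatewise multiplication (its elements have coordinates $\pm1$) and on $T_P$ by multiplication, hence freely on $\mathcal R_P\times T_P$ by the diagonal action. Let $N_P=\mathcal R_P\times_{D_P}T_P$ be the quotient, an $m$-dimensional smooth manifold. Then the map $$N_P\to\mathbb C^m,\qquad [\mathbf u,\mathbf t]\mapsto(u_1t_1,\dots,u_mt_m),$$ is a smooth embedding (an immersion that is a homeomorphism onto its image) if and only if $P$ is *Delzant*, that is, it is rational and for every $\mathbf x\in P$ any vectors $\mathbf a_{j_1},\dots,\mathbf a_{j_k}$ with distinct indices $j_1,\dots,j_k$ and $\langle\mathbf a_{j_l},\mathbf x\rangle+b_{j_l}=0$ for $l=1,\dots,k$ constitute a part of a $\mathbb Z$-basis of $\Lambda$. -/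

import Mathlib

open scoped ContDiff Manifold Topology

namespace PolyhedronPresentation

/-! ### Smooth structures pushed forward along a surjective local homeomorphism -/

section Pushforward

variable {E H X Y : Type*} [NormedAddCommGroup E] [NormedSpace ℝ E] [TopologicalSpace H]
  (I : ModelWithCorners ℝ E H) (r : WithTop ℕ∞) [TopologicalSpace X] [ChartedSpace H X]
  [TopologicalSpace Y] {f : X → Y} (hf : IsLocalHomeomorph f)
  (hs : Function.Surjective f)

theorem pushforward_deck_eventually (x : X) {p : X} {h : X → X} (hc : ContinuousAt h p)
    (hfh : f ∘ h = f) (hp : h p ∈ (hf.localInverseAt x).target) :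
    ∀ᶠ q in 𝓝 p, hf.localInverseAt x (f q) = h q := by
  filter_upwards [hc.eventually ((hf.localInverseAt x).open_target.mem_nhds hp)] with q hq
  have h1 : f q = f (h q) := (congrFun hfh q).symm
  rw [h1]
  have := (hf.localInverseAt x).right_inv hq
  simpa using this

theorem pushforward_isManifold [IsManifold I r X]
    (deck : ∀ x x', f x = f x' → ∃ h : X → X, ContMDiff I I r h ∧ h x = x' ∧ f ∘ h = f) :
    letI := hf.chartedSpace (H := H) hs
    IsManifold I r Y := by
  let _ := hf.chartedSpace (H := H) hs
  apply isManifold_of_contDiffOn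
  rintro _ _ ⟨y, rfl⟩ ⟨y', rfl⟩
  set x := hs.hasRightInverse.choose y
  set x' := hs.hasRightInverse.choose y'
  rintro z ⟨hz, hz'⟩
  obtain ⟨w, rfl⟩ := hz'
  simp only [Set.mem_preimage, I.left_inv] at hz
  simp only [OpenPartialHomeomorph.trans_source, OpenPartialHomeomorph.symm_source,
    OpenPartialHomeomorph.trans_target, Set.mem_inter_iff, Set.mem_preimage] at hz
  obtain ⟨⟨hw1, hw2⟩, hw3, hw4⟩ := hz
  set p := (chartAt H x).symm w with hp
  have hfp : ((hf.localInverseAt x).trans (chartAt H x)).symm w = f p := by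
    simp [hp]
  rw [hfp] at hw3 hw4
  set p' := hf.localInverseAt x' (f p) with hp'
  have hpp' : f p = f p' := by
    have := (hf.localInverseAt x').left_inv hw3
    simpa using this.symm
  obtain ⟨h, hh, hhp, hfh⟩ := deck p p' hpp'
  have hpt : h p ∈ (hf.localInverseAt x').target := by
    rw [hhp]; exact (hf.localInverseAt x').map_source hw3
  have hev := pushforward_deck_eventually hf x' hh.continuous.continuousAt hfh hpt
  have hps : p ∈ (chartAt H x).source := (chartAt H x).map_target hw1
  have hcd := ((contMDiffAt_iff_of_mem_source (I := I) (I' := I) (x := x) (y := x') hps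
    (by rw [hhp]; exact hw4)).1 (hh p)).2
  have hpw : extChartAt I x p = I w := by simp [hp, hw1]
  rw [hpw] at hcd
  refine (hcd.mono Set.inter_subset_right).congr_of_eventuallyEq ?_ ?_
  · have hcont : ContinuousAt (fun v => (chartAt H x).symm (I.symm v)) (I w) := by
      apply ContinuousAt.comp
      · rw [I.left_inv]; exact (chartAt H x).continuousAt_symm hw1
      · exact I.continuous_symm.continuousAt
    have hev' : ∀ᶠ v in 𝓝 (I w), hf.localInverseAt x' (f ((chartAt H x).symm (I.symm v)))
        = h ((chartAt H x).symm (I.symm v)) := by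
      refine hcont.eventually (p := fun q => hf.localInverseAt x' (f q) = h q) ?_
      simpa [I.left_inv] using hev
    filter_upwards [mem_nhdsWithin_of_mem_nhds hev'] with v hv
    simp [hv]
  · have := hev.self_of_nhds
    simp [I.left_inv, ← hp, this]

theorem pushforward_contMDiff_of_comp {E' H' Z : Type*} [NormedAddCommGroup E'] [NormedSpace ℝ E']
    [TopologicalSpace H'] {I' : ModelWithCorners ℝ E' H'} [TopologicalSpace Z] [ChartedSpace H' Z]
    [IsManifold I' r Z] {g : Y → Z} (hg : ContMDiff I I' r (g ∘ f)) :
    letI := hf.chartedSpace (H := H) hs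
    ContMDiff I I' r g := by
  let _ := hf.chartedSpace (H := H) hs
  intro y
  have hcont : Continuous g := by
    exact (hf.isOpenMap.isQuotientMap hf.continuous hs).continuous_iff.2 hg.continuous
  rw [contMDiffAt_iff]
  refine ⟨hcont.continuousAt, ?_⟩
  set x := hs.hasRightInverse.choose y
  have hx : f x = y := hs.hasRightInverse.choose_spec y
  have hch : chartAt H y = (hf.localInverseAt x).trans (chartAt H x) := rfl
  have := (contMDiffAt_iff.1 (hg x)).2
  have e1 : extChartAt I y y = extChartAt I x x := by
    simp only [extChartAt, hch]
    rw [← hx]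
    simp
  rw [e1]
  have e2 : (extChartAt I' (g y)) ∘ g ∘ (extChartAt I y).symm =
      (extChartAt I' ((g ∘ f) x)) ∘ (g ∘ f) ∘ (extChartAt I x).symm := by
    funext v
    simp [extChartAt, hch, hx]
  rw [e2]
  exact this

theorem pushforward_contMDiff
    (deck : ∀ x x', f x = f x' → ∃ h : X → X, ContMDiff I I r h ∧ h x = x' ∧ f ∘ h = f) :
    letI := hf.chartedSpace (H := H) hs
    ContMDiff I I r f := by
  let _ := hf.chartedSpace (H := H) hs
  intro p
  rw [contMDiffAt_iff]
  refine ⟨hf.continuous.continuousAt, ?_⟩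
  set x := hs.hasRightInverse.choose (f p)
  have hx : f x = f p := hs.hasRightInverse.choose_spec (f p)
  have hch : chartAt H (f p) = (hf.localInverseAt x).trans (chartAt H x) := rfl
  obtain ⟨h, hh, hhp, hfh⟩ := deck p x hx.symm
  have hev := pushforward_deck_eventually hf x hh.continuous.continuousAt hfh
    (by rw [hhp]; simp)
  have hcd := (contMDiffAt_iff.1 (hh p)).2
  rw [hhp] at hcd
  refine hcd.congr_of_eventuallyEq ?_ ?_
  · have := (continuousAt_extChartAt_symm (I := I) p).eventually
      (by simpa using hev)
    filter_upwards [mem_nhdsWithin_of_mem_nhds this] with v hv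
    simp [extChartAt, hch] at hv ⊢
    rw [hv]
  · simp [extChartAt, hch, hev.self_of_nhds]

end Pushforward
end PolyhedronPresentation

/-- A presentation of a polyhedron in `ℝⁿ` by `m` linear inequalities `⟨a i, x⟩ + b i ≥ 0`, where
`a = normal` and `b = offset`. Redundant inequalities are allowed. -/
structure PolyhedronPresentation (n m : ℕ) where
  normal : Fin m → EuclideanSpace ℝ (Fin n)
  offset : Fin m → ℝ

namespace PolyhedronPresentation

variable {n m : ℕ} (P : PolyhedronPresentation n m)

/-- The value `⟨a i, x⟩ + b i` of the `i`-th affine function at `x`. -/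
noncomputable def slack (x : EuclideanSpace ℝ (Fin n)) (i : Fin m) : ℝ :=
  inner ℝ (P.normal i) x + P.offset i

/-- The polyhedron `P = {x | ⟨a i, x⟩ + b i ≥ 0 for all i}`. -/
def polyhedron : Set (EuclideanSpace ℝ (Fin n)) :=
  {x | ∀ i, 0 ≤ P.slack x i}

/-- A presentation is generic if the polyhedron is `n`-dimensional, has a vertex (extreme point), and
the hyperplanes `⟨a i, x⟩ + b i = 0` are in general position at every point of the polyhedron, that
is, the normals of the hyperplanes through the point are linearly independent. -/
class IsGeneric : Prop where
  full_dimensional : affineSpan ℝ P.polyhedron = ⊤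
  has_vertex : (P.polyhedron.extremePoints ℝ).Nonempty
  general_position : ∀ x ∈ P.polyhedron,
    LinearIndependent ℝ (fun i : {i : Fin m // P.slack x i = 0} => P.normal i)

/-- The group `Λ = ℤ⟨a 1, …, a m⟩`. -/
def lattice : Submodule ℤ (EuclideanSpace ℝ (Fin n)) :=
  Submodule.span ℤ (Set.range P.normal)

/-- A presentation is rational if its normals generate a lattice (discrete subgroup) in `ℝⁿ`. -/
class IsRational : Prop where
  discrete : DiscreteTopology P.lattice

/-- Delzant: rational, and for every point `x` of the polyhedron, any normals `a j`, `j ∈ J`, of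
hyperplanes through `x` constitute a part of a `ℤ`-basis of `Λ`. -/
structure IsDelzant : Prop where
  rational : P.IsRational
  part_of_basis : ∀ x ∈ P.polyhedron, ∀ J : Finset (Fin m), (∀ j ∈ J, P.slack x j = 0) →
    ∃ (k : ℕ) (β : Module.Basis (Fin k) ℤ P.lattice) (e : J ↪ Fin k),
      ∀ j : J, (β (e j) : EuclideanSpace ℝ (Fin n)) = P.normal j

/-- The real moment-angle manifold `ℛ_P`: the preimage of `i_P(P)`, where `i_P x = (⟨a i, x⟩ + b i)_i`,
under the map `u ↦ (u i ^ 2)_i` of `ℝᵐ`. -/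
def realMomentAngle : Set (EuclideanSpace ℝ (Fin m)) :=
  {u | ∃ x ∈ P.polyhedron, ∀ i, u i ^ 2 = P.slack x i}

/-- The transpose `χ ↦ ∑ k, χ k • a k` of the linear part of `i_P`. -/
noncomputable def normalSum : EuclideanSpace ℝ (Fin m) →ₗ[ℝ] EuclideanSpace ℝ (Fin n) where
  toFun χ := ∑ k, χ k • P.normal k
  map_add' χ ψ := by simp [add_smul, Finset.sum_add_distrib]
  map_smul' c χ := by simp [mul_smul, Finset.smul_sum]

/-- The universal covering `χ ↦ (exp (2πi χ k))_k` of the standard torus `𝕋ᵐ = ℝᵐ / ℤᵐ`. -/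
noncomputable def torusExp (χ : EuclideanSpace ℝ (Fin m)) : Fin m → Circle :=
  fun k => Circle.exp (2 * Real.pi * χ k)

theorem torusExp_add (χ ψ : EuclideanSpace ℝ (Fin m)) :
    torusExp (χ + ψ) = torusExp χ * torusExp ψ := by
  funext k
  simp [torusExp, mul_add, Circle.exp_add]

theorem torusExp_neg (χ : EuclideanSpace ℝ (Fin m)) :
    torusExp (-χ) = (torusExp χ)⁻¹ := by
  funext k
  simp [torusExp, Circle.exp_neg]

/-- The torus `T_P`: the kernel of the homomorphism `ℝᵐ / ℤᵐ → ℝⁿ / Λ`, `χ ↦ ∑ k, χ k • a k`,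
viewed in `𝕋ᵐ`. -/
def torus : Subgroup (Fin m → Circle) where
  carrier := {t | ∃ χ, P.normalSum χ ∈ P.lattice ∧ torusExp χ = t}
  one_mem' := ⟨0, by simp, by funext k; simp [torusExp]⟩
  mul_mem' := by
    rintro _ _ ⟨χ, hχ, rfl⟩ ⟨ψ, hψ, rfl⟩
    exact ⟨χ + ψ, by rw [map_add]; exact add_mem hχ hψ, torusExp_add χ ψ⟩
  inv_mem' := by
    rintro _ ⟨χ, hχ, rfl⟩
    exact ⟨-χ, by rw [map_neg]; exact neg_mem hχ, torusExp_neg χ⟩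

/-- The group `D_P` of elements `g` of `T_P` with `g ^ 2 = 1`. Writing `T_P = K / L*` with
`K = ker (χ ↦ ∑ k, χ k • a k)` and `L* = K ∩ ℤᵐ`, this is `½L* / L*`. -/
def signGroup : Subgroup P.torus where
  carrier := {g | g ^ 2 = 1}
  one_mem' := by simp
  mul_mem' := by
    intro a b ha hb
    simp only [Set.mem_ofPred_eq] at *
    rw [mul_pow, ha, hb, one_mul]
  inv_mem' := by
    intro a ha
    simp only [Set.mem_ofPred_eq] at *
    rw [inv_pow, ha, inv_one]

/-- The `k`-th coordinate of `g ∈ D_P ⊆ 𝕋ᵐ`; it is `1` or `-1`. -/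
def sgn (g : P.signGroup) (k : Fin m) : Circle := ((g : P.torus) : Fin m → Circle) k

theorem sgn_eq (g : P.signGroup) (k : Fin m) :
    (P.sgn g k : ℂ) = 1 ∨ (P.sgn g k : ℂ) = -1 := by
  have h : (g : P.torus) ^ 2 = 1 := g.2
  have h1 : (P.sgn g k) ^ 2 = 1 := congrFun (congrArg (fun t : P.torus => (t : Fin m → Circle)) h) k
  have h2 : (P.sgn g k : ℂ) ^ 2 = 1 := by exact_mod_cast congrArg (fun z : Circle => (z : ℂ)) h1
  exact mul_self_eq_one_iff.mp (by rw [← sq]; exact h2)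


/-- `D_P` acts on `ℛ_P` by coordinatewise multiplication with its coordinates `±1`. -/
noncomputable instance realMomentAngleMulAction : MulAction P.signGroup P.realMomentAngle where
  smul g u := ⟨WithLp.toLp 2 fun k => (P.sgn g k : ℂ).re * u.1 k, by
    obtain ⟨x, hx, h⟩ := u.2
    refine ⟨x, hx, fun i => ?_⟩
    rw [← h i]
    rcases P.sgn_eq g i with h | h <;> simp [h]⟩
  one_smul u := by
    apply Subtype.ext
    ext k
    change (P.sgn 1 k : ℂ).re * u.1 k = u.1 k
    simp [sgn]
  mul_smul g h u := by
    apply Subtype.ext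
    ext k
    change (P.sgn (g * h) k : ℂ).re * u.1 k = (P.sgn g k : ℂ).re * ((P.sgn h k : ℂ).re * u.1 k)
    have : P.sgn (g * h) k = P.sgn g k * P.sgn h k := rfl
    rw [this, Circle.coe_mul]
    rcases P.sgn_eq g k with h1 | h1 <;> rcases P.sgn_eq h k with h2 | h2 <;> simp [h1, h2]

theorem smul_coe (g : P.signGroup) (u : P.realMomentAngle) (k : Fin m) :
    (((g • u : P.realMomentAngle) : EuclideanSpace ℝ (Fin m)) k : ℂ) = P.sgn g k * u.1 k := by
  change (((P.sgn g k : ℂ).re * u.1 k : ℝ) : ℂ) = _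
  rcases P.sgn_eq g k with h | h <;> simp [h]

/-- `N_P = ℛ_P ×_{D_P} T_P`: the quotient of `ℛ_P × T_P` by the diagonal action of `D_P`, which acts
on the second factor by multiplication in `T_P`. It carries the quotient topology. -/
abbrev quotientSpace : Type :=
  MulAction.orbitRel.Quotient P.signGroup (P.realMomentAngle × P.torus)

/-- The map `j : ℛ_P × T_P → ℂᵐ`, `(u, t) ↦ (u k * t k)_k`. -/
noncomputable def coverMap (p : P.realMomentAngle × P.torus) : EuclideanSpace ℂ (Fin m) :=
  WithLp.toLp 2 fun k => (p.1.1 k : ℂ) * (p.2.1 k : ℂ)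

/-- The map `N_P → ℂᵐ` induced by `j`. -/
noncomputable def quotientMap : P.quotientSpace → EuclideanSpace ℂ (Fin m) :=
  Quotient.lift P.coverMap (by
    rintro p q ⟨g, rfl⟩
    ext k
    change ((g • q.1 : P.realMomentAngle).1 k : ℂ) * ((P.sgn g k * q.2.1 k : Circle) : ℂ)
      = (q.1.1 k : ℂ) * (q.2.1 k : ℂ)
    rw [smul_coe, Circle.coe_mul]
    rcases P.sgn_eq g k with h | h <;> simp [h])

instance signGroupFinite : Finite P.signGroup := by
  have : Function.Injective (fun (g : P.signGroup) (k : Fin m) => decide ((P.sgn g k : ℂ) = 1)) := by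
    intro g h hgh
    apply Subtype.ext; apply Subtype.ext; funext k
    have := congrFun hgh k
    simp only [decide_eq_decide] at this
    apply Circle.ext
    change (P.sgn g k : ℂ) = P.sgn h k
    rcases P.sgn_eq g k with h1 | h1 <;> rcases P.sgn_eq h k with h2 | h2 <;> simp_all
  exact Finite.of_injective _ this

instance realMomentAngleContinuousConstSMul :
    ContinuousConstSMul P.signGroup P.realMomentAngle where
  continuous_const_smul g := by
    apply Continuous.subtype_mk
    fun_prop


instance productIsCancelSMul :
    IsCancelSMul P.signGroup (P.realMomentAngle × P.torus) where
  left_cancel' g x y h := smul_left_cancel g h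
  right_cancel' g h x hx := by
    have h2 : (g : P.torus) * x.2 = (h : P.torus) * x.2 := congrArg Prod.snd hx
    exact Subtype.ext (mul_right_cancel h2)

/-! ### The smooth structure on `T_P` -/

/-- The space `K` of linear relations between the normals. It has dimension `m - n` if the
presentation is generic. -/
noncomputable def relations : Submodule ℝ (EuclideanSpace ℝ (Fin m)) := LinearMap.ker P.normalSum

/-- The universal covering `K → T_P`, `χ ↦ (exp (2πi χ k))_k`. -/
noncomputable def relationsExp (χ : P.relations) : P.torus :=
  ⟨torusExp χ.1, χ.1, by rw [show P.normalSum χ.1 = 0 from χ.2]; exact zero_mem _, rfl⟩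

theorem normalSum_sub_mem {χ ψ : EuclideanSpace ℝ (Fin m)} (h : torusExp χ = torusExp ψ) :
    P.normalSum χ - P.normalSum ψ ∈ P.lattice := by
  have h1 : ∀ k, ∃ z : ℤ, χ k - ψ k = z := by
    intro k
    have := congrFun h k
    simp only [torusExp] at this
    obtain ⟨z, hz⟩ := Circle.exp_eq_exp.1 this
    refine ⟨z, ?_⟩
    have hpi := Real.pi_pos
    have : 2 * Real.pi * (χ k - ψ k - z) = 0 := by linarith
    have := (mul_eq_zero.1 this).resolve_left (by positivity)
    linarith
  choose z hz using h1
  have : P.normalSum χ - P.normalSum ψ = ∑ k, z k • P.normal k := by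
    rw [← map_sub]
    change ∑ k, (χ - ψ) k • P.normal k = _
    refine Finset.sum_congr rfl fun k _ => ?_
    rw [← Int.cast_smul_eq_zsmul ℝ, ← hz k]
    rfl
  rw [this]
  exact sum_mem fun k _ => P.lattice.smul_mem _ (Submodule.subset_span ⟨k, rfl⟩)

theorem relationsExp_surjective : Function.Surjective P.relationsExp := by
  rintro ⟨t, χ, hχ, rfl⟩
  obtain ⟨z, hz⟩ := (Submodule.mem_span_range_iff_exists_fun ℤ).1 hχ
  let ψ : EuclideanSpace ℝ (Fin m) := WithLp.toLp 2 fun k => (z k : ℝ)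
  have hψ : P.normalSum ψ = P.normalSum χ := by
    rw [← hz]
    change ∑ k, (z k : ℝ) • P.normal k = _
    simp [Int.cast_smul_eq_zsmul]
  refine ⟨⟨χ - ψ, ?_⟩, Subtype.ext ?_⟩
  · change P.normalSum (χ - ψ) = 0
    rw [map_sub, hψ, sub_self]
  · change torusExp (χ - ψ) = torusExp χ
    rw [sub_eq_add_neg, torusExp_add, torusExp_neg]
    have : torusExp ψ = 1 := by
      funext k
      simp only [torusExp, Pi.one_apply, ψ]
      exact Circle.exp_eq_one.2 ⟨z k, by ring⟩
    simp [this]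

theorem torusExp_isLocalHomeomorph :
    IsLocalHomeomorph (torusExp : EuclideanSpace ℝ (Fin m) → Fin m → Circle) := by
  have h1 : IsLocalHomeomorph (fun (v : Fin m → ℝ) k => Circle.exp (v k)) := by
    refine IsLocalHomeomorph.mk _ fun v => ?_
    choose e he he' using fun k => isLocalHomeomorph_circleExp (v k)
    refine ⟨OpenPartialHomeomorph.pi e, fun k _ => he k, fun w _ => ?_⟩
    funext k
    exact congrFun (he' k) (w k)
  have h2 : IsLocalHomeomorph (fun v : EuclideanSpace ℝ (Fin m) => (2 * Real.pi) • v) :=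
    (Homeomorph.smulOfNeZero (2 * Real.pi) (by positivity)).isLocalHomeomorph
  have h3 : IsLocalHomeomorph (fun v : EuclideanSpace ℝ (Fin m) => (v.ofLp : Fin m → ℝ)) :=
    (PiLp.homeomorph 2 (fun _ : Fin m => ℝ)).isLocalHomeomorph
  exact h1.comp (h3.comp h2)

theorem relationsExp_isLocalHomeomorph [hr : P.IsRational] :
    IsLocalHomeomorph P.relationsExp := by
  have hT := torusExp_isLocalHomeomorph (m := m)
  have hc : Continuous P.relationsExp :=
    (hT.continuous.comp continuous_subtype_val).subtype_mk _
  have hN : Continuous (P.normalSum : EuclideanSpace ℝ (Fin m) → EuclideanSpace ℝ (Fin n)) :=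
    P.normalSum.continuous_of_finiteDimensional
  have ho : IsOpenMap P.relationsExp := by
    refine IsOpenMap.of_nhds_le fun χ => ?_
    intro s hs
    rw [Filter.mem_map, nhds_subtype_eq_comap, Filter.mem_comap] at hs
    obtain ⟨V, hV, hVs⟩ := hs
    have hdisc := hr.discrete
    obtain ⟨W, hW, hW0⟩ : ∃ W ∈ 𝓝 (0 : EuclideanSpace ℝ (Fin n)),
        ∀ w ∈ W, w ∈ P.lattice → w = 0 := by
      have h0 : ({0} : Set P.lattice) ∈ 𝓝 (0 : P.lattice) := by simp
      rw [nhds_subtype_eq_comap, Filter.mem_comap] at h0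
      obtain ⟨W, hW, hW0⟩ := h0
      refine ⟨W, hW, fun w hw hw' => ?_⟩
      have : (⟨w, hw'⟩ : P.lattice) ∈ ({0} : Set P.lattice) := hW0 hw
      exact congrArg Subtype.val this
    have hχ0 : P.normalSum χ.1 = 0 := χ.2
    have hW' : P.normalSum ⁻¹' W ∈ 𝓝 χ.1 := hN.continuousAt (by rw [hχ0]; exact hW)
    have hO : torusExp '' (V ∩ P.normalSum ⁻¹' W) ∈ 𝓝 (torusExp χ.1) :=
      hT.isOpenMap.image_mem_nhds (Filter.inter_mem hV hW')
    rw [nhds_subtype_eq_comap, Filter.mem_comap]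
    refine ⟨_, hO, ?_⟩
    rintro t ⟨ψ, ⟨hψV, hψW⟩, hψ⟩
    obtain ⟨ξ, hξ, hξt⟩ := t.2
    have hmem : P.normalSum ψ ∈ P.lattice := by
      have := P.normalSum_sub_mem (hψ.trans hξt.symm)
      simpa using add_mem this hξ
    have h0 : P.normalSum ψ = 0 := hW0 _ hψW hmem
    have := hVs (show (⟨ψ, h0⟩ : P.relations) ∈ Subtype.val ⁻¹' V from hψV)
    have he : P.relationsExp ⟨ψ, h0⟩ = t := Subtype.ext hψ
    rw [← he]
    exact this
  rw [isLocalHomeomorph_iff_isOpenEmbedding_restrict]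
  intro χ
  obtain ⟨U, hU, hUχ, hinj⟩ := hT.isLocallyInjective χ.1
  refine ⟨Subtype.val ⁻¹' U, (hU.preimage continuous_subtype_val).mem_nhds hUχ, ?_⟩
  refine Topology.IsOpenEmbedding.of_continuous_injective_isOpenMap
    (hc.comp continuous_subtype_val) ?_
    (ho.comp (hU.preimage continuous_subtype_val).isOpenMap_subtype_val)
  intro a b hab
  apply Subtype.ext; apply Subtype.ext
  exact hinj a.2 b.2 (congrArg Subtype.val hab)

/-- The smooth structure on `T_P = K / (K ∩ ℤᵐ)`: the charts are the local inverses of the covering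
map `K → T_P`. -/
noncomputable instance torusChartedSpace [P.IsRational] : ChartedSpace P.relations P.torus :=
  P.relationsExp_isLocalHomeomorph.chartedSpace P.relationsExp_surjective

/-! ### The smooth structure on `ℛ_P` -/

/-- The quadratic map `ℝᵐ → K` which has `ℛ_P` as its zero set: a vector lies in `i_P(ℝⁿ)` if and only
if its difference with `b` is orthogonal to `K`. -/
noncomputable def quadrics (u : EuclideanSpace ℝ (Fin m)) : P.relations :=
  P.relations.orthogonalProjectionOnto (WithLp.toLp 2 fun k => u k ^ 2 - P.offset k)

theorem mem_realMomentAngle_iff (u : EuclideanSpace ℝ (Fin m)) :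
    u ∈ P.realMomentAngle ↔ P.quadrics u = 0 := by
  have hadj : ∀ x k, (LinearMap.adjoint P.normalSum x) k = inner ℝ (P.normal k) x := by
    intro x k
    have h := LinearMap.adjoint_inner_right P.normalSum (EuclideanSpace.single k (1 : ℝ)) x
    rw [EuclideanSpace.inner_single_left] at h
    simp only [map_one, one_mul] at h
    rw [h]
    congr 1
    change ∑ j, (EuclideanSpace.single k (1 : ℝ)) j • P.normal j = _
    simp [ite_smul]
  rw [quadrics, Submodule.orthogonalProjectionOnto_eq_zero_iff, relations,
    LinearMap.orthogonal_ker]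
  constructor
  · rintro ⟨x, -, hx⟩
    refine ⟨x, ?_⟩
    ext k
    rw [hadj]
    simp [hx k, slack]
  · rintro ⟨x, hx⟩
    have h : ∀ i, u i ^ 2 = P.slack x i := by
      intro i
      have := congrArg (fun v : EuclideanSpace ℝ (Fin m) => v i) hx
      simp only [hadj] at this
      rw [slack, this]
      ring
    exact ⟨x, fun i => by rw [← h i]; positivity, h⟩

theorem quadrics_contDiff : ContDiff ℝ ω P.quadrics := by
  refine P.relations.orthogonalProjectionOnto.contDiff.comp ?_
  refine (PiLp.contDiff_toLp).comp (contDiff_pi.2 fun k => ?_)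
  fun_prop

/-- The derivative `v ↦ (2 * u k * v k)_k` of `u ↦ (u k ^ 2)_k`. -/
noncomputable def doubleMul (u : EuclideanSpace ℝ (Fin m)) :
    EuclideanSpace ℝ (Fin m) →L[ℝ] EuclideanSpace ℝ (Fin m) :=
  LinearMap.toContinuousLinearMap
    { toFun := fun v => WithLp.toLp 2 fun k => 2 * u k * v k
      map_add' := by intro v w; ext k; simp [mul_add]
      map_smul' := by intro c v; ext k; simp; ring }

theorem quadrics_hasFDerivAt (u : EuclideanSpace ℝ (Fin m)) :
    HasFDerivAt P.quadrics (P.relations.orthogonalProjectionOnto ∘L doubleMul u) u := by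
  refine P.relations.orthogonalProjectionOnto.hasFDerivAt.comp u ?_
  rw [← hasFDerivWithinAt_univ, hasFDerivWithinAt_piLp]
  intro k
  rw [hasFDerivWithinAt_univ]
  have h1 : HasFDerivAt (fun v : EuclideanSpace ℝ (Fin m) => v k)
      (EuclideanSpace.proj k : EuclideanSpace ℝ (Fin m) →L[ℝ] ℝ) u :=
    (EuclideanSpace.proj k : EuclideanSpace ℝ (Fin m) →L[ℝ] ℝ).hasFDerivAt
  have h2 := (h1.pow 2).sub_const (P.offset k)
  refine h2.congr_fderiv ?_
  ext v
  simp [doubleMul]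

theorem quadrics_fderiv_surjective [hg : P.IsGeneric] {u : EuclideanSpace ℝ (Fin m)}
    (hu : u ∈ P.realMomentAngle) :
    Function.Surjective (P.relations.orthogonalProjectionOnto ∘L doubleMul u) := by
  change Function.Surjective (P.relations.orthogonalProjectionOnto ∘L doubleMul u).toLinearMap
  rw [← LinearMap.range_eq_top, ← Submodule.orthogonal_eq_bot_iff, Submodule.eq_bot_iff]
  intro χ hχ
  have h1 : ∀ v, inner ℝ (doubleMul u v) χ.1 = 0 := by
    intro v
    have := (Submodule.mem_orthogonal _ _).1 hχ _ ⟨v, rfl⟩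
    simpa using this
  have h2 : ∀ k, u k * χ.1 k = 0 := by
    intro k
    have := h1 (EuclideanSpace.single k 1)
    have e : doubleMul u (EuclideanSpace.single k 1) = EuclideanSpace.single k (2 * u k) := by
      ext j
      by_cases h : j = k
      · subst h; simp [doubleMul]
      · simp [doubleMul, h]
    rw [e, EuclideanSpace.inner_single_left] at this
    simp at this
    rcases this with h | h <;> simp [h]
  obtain ⟨x, hx, hux⟩ := hu
  have hli := hg.general_position x hx
  rw [Fintype.linearIndependent_iff] at hli
  have hsum : ∑ i : {i : Fin m // P.slack x i = 0}, χ.1 i • P.normal i = 0 := by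
    have h0 : ∑ k, χ.1 k • P.normal k = 0 := χ.2
    have hz : ∀ k, P.slack x k ≠ 0 → χ.1 k = 0 := by
      intro k hk
      have : u k ≠ 0 := by
        intro h
        rw [← hux k, h] at hk
        simp at hk
      simpa [this] using h2 k
    rw [← h0]
    refine Finset.sum_bij_ne_zero (fun i _ _ => i.1) (by simp) (by
      intro a _ _ b _ _ h; exact Subtype.ext h) ?_ (by simp)
    intro k _ hk
    refine ⟨⟨k, ?_⟩, by simp, hk, rfl⟩
    by_contra hne
    exact hk (by simp [hz k hne])
  apply Subtype.ext
  ext k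
  by_cases hk : P.slack x k = 0
  · exact hli (fun i => χ.1 i) hsum ⟨k, hk⟩
  · have : u k ≠ 0 := by
      intro h
      rw [← hux k, h] at hk
      simp at hk
    simpa [this] using h2 k

theorem normalSum_surjective [hg : P.IsGeneric] : Function.Surjective P.normalSum := by
  rw [← LinearMap.range_eq_top, ← Submodule.orthogonal_eq_bot_iff, Submodule.eq_bot_iff]
  intro v hv
  have h1 : ∀ k, inner ℝ (P.normal k) v = 0 := by
    intro k
    refine (Submodule.mem_orthogonal _ _).1 hv _ ⟨EuclideanSpace.single k 1, ?_⟩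
    change ∑ j, (EuclideanSpace.single k (1 : ℝ)) j • P.normal j = _
    simp [ite_smul]
  obtain ⟨x, hx⟩ := hg.has_vertex
  have hp : x + v ∈ P.polyhedron := fun i => by
    have := hx.1 i
    simpa [slack, inner_add_right, h1 i] using this
  have hm : x - v ∈ P.polyhedron := fun i => by
    have := hx.1 i
    simpa [slack, inner_sub_right, h1 i] using this
  have hseg : x ∈ openSegment ℝ (x + v) (x - v) :=
    ⟨1 / 2, 1 / 2, by norm_num, by norm_num, by norm_num, by module⟩
  have := hx.2 hp hm hseg
  simpa using this

theorem finrank_relations [P.IsGeneric] : Module.finrank ℝ P.relations + n = m := by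
  have := P.normalSum.finrank_range_add_finrank_ker
  rw [LinearMap.range_eq_top.2 P.normalSum_surjective, finrank_top] at this
  simp only [finrank_euclideanSpace_fin] at this
  rw [relations]
  omega

/-- Local analytic coordinates on `ℝᵐ`, with values in `K × ℝⁿ`, in which `ℛ_P` is the slice
`{0} × ℝⁿ`: the first component is the map `quadrics`. -/
structure IsStraightening
    (Φ : OpenPartialHomeomorph (EuclideanSpace ℝ (Fin m))
      (P.relations × EuclideanSpace ℝ (Fin n))) : Prop where
  contDiffOn : ContDiffOn ℝ ω Φ Φ.source
  contDiffOn_symm : ContDiffOn ℝ ω Φ.symm Φ.target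
  fst_eq : ∀ u ∈ Φ.source, (Φ u).1 = P.quadrics u

theorem exists_isStraightening [P.IsGeneric] (u : P.realMomentAngle) :
    ∃ Φ, P.IsStraightening Φ ∧ u.1 ∈ Φ.source := by
  set A := P.relations.orthogonalProjectionOnto ∘L doubleMul u.1 with hA
  have hsurj : Function.Surjective A := P.quadrics_fderiv_surjective u.2
  have hrank : Module.finrank ℝ (LinearMap.ker A.toLinearMap) = n := by
    have h1 := A.toLinearMap.finrank_range_add_finrank_ker
    rw [LinearMap.range_eq_top.2 hsurj, finrank_top] at h1
    have h2 := P.finrank_relations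
    simp only [finrank_euclideanSpace_fin] at h1
    omega
  obtain ⟨p, hp⟩ := A.ker_closedComplemented_of_finiteDimensional_range
  let ε : LinearMap.ker A.toLinearMap ≃L[ℝ] EuclideanSpace ℝ (Fin n) :=
    ContinuousLinearEquiv.ofFinrankEq (by simp [hrank])
  let B : EuclideanSpace ℝ (Fin m) →L[ℝ] P.relations × EuclideanSpace ℝ (Fin n) :=
    A.prod (ε.toContinuousLinearMap ∘L p)
  have hinj : Function.Injective B := by
    rw [injective_iff_map_eq_zero]
    intro v hv
    have h1 : A v = 0 := congrArg Prod.fst hv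
    have h2 : ε (p v) = 0 := congrArg Prod.snd hv
    have h3 : p v = 0 := by simpa using h2
    have h4 := hp ⟨v, h1⟩
    rw [h3] at h4
    exact (congrArg Subtype.val h4).symm
  let e : EuclideanSpace ℝ (Fin m) ≃L[ℝ] P.relations × EuclideanSpace ℝ (Fin n) :=
    (LinearEquiv.ofInjectiveOfFinrankEq B.toLinearMap hinj
      (by simp [P.finrank_relations])).toContinuousLinearEquiv
  let G : EuclideanSpace ℝ (Fin m) → P.relations × EuclideanSpace ℝ (Fin n) :=
    fun v => (P.quadrics v, ε (p v))
  have hG : ContDiff ℝ ω G :=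
    P.quadrics_contDiff.prodMk (ε.contDiff.comp p.contDiff)
  have hG' : HasFDerivAt G (e : EuclideanSpace ℝ (Fin m) →L[ℝ] _) u.1 :=
    (P.quadrics_hasFDerivAt u.1).prodMk (ε.toContinuousLinearMap ∘L p).hasFDerivAt
  have hω : (ω : WithTop ℕ∞) ≠ 0 := by simp
  let Φ₀ := (hG.contDiffAt (x := u.1)).toOpenPartialHomeomorph G hG' hω
  have hu₀ : u.1 ∈ Φ₀.source :=
    (hG.contDiffAt (x := u.1)).mem_toOpenPartialHomeomorph_source hG' hω
  have hω' : (ω : WithTop ℕ∞) ≠ ∞ := by simp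
  refine ⟨Φ₀.restrContDiff ℝ ω hω', ⟨?_, ?_, ?_⟩, ?_⟩
  · exact Φ₀.contDiffOn_restrContDiff_source ℝ hω'
  · exact Φ₀.contDiffOn_restrContDiff_target ℝ hω'
  · intro v _; rfl
  · refine ⟨hu₀, hG.contDiffAt, ?_⟩
    exact Φ₀.contDiffAt_symm (f₀' := e) (Φ₀.map_source hu₀)
      (by rw [Φ₀.left_inv hu₀]; exact hG') (by rw [Φ₀.left_inv hu₀]; exact hG.contDiffAt)

open Classical in
/-- The chart of `ℛ_P` given by the restriction of straightening coordinates to the slice. -/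
noncomputable def sliceChart (u₀ : P.realMomentAngle)
    (Φ : OpenPartialHomeomorph (EuclideanSpace ℝ (Fin m))
      (P.relations × EuclideanSpace ℝ (Fin n))) (hΦ : P.IsStraightening Φ) :
    OpenPartialHomeomorph P.realMomentAngle (EuclideanSpace ℝ (Fin n)) where
  toFun u := (Φ u.1).2
  invFun w := if h : ((0 : P.relations), w) ∈ Φ.target then
      ⟨Φ.symm (0, w), (P.mem_realMomentAngle_iff _).2 (by
        rw [← hΦ.fst_eq _ (Φ.map_target h), Φ.right_inv h])⟩
    else u₀
  source := Subtype.val ⁻¹' Φ.source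
  target := {w | ((0 : P.relations), w) ∈ Φ.target}
  map_source' u hu := by
    have h0 : (Φ u.1).1 = 0 := (hΦ.fst_eq _ hu).trans ((P.mem_realMomentAngle_iff _).1 u.2)
    change (0, (Φ u.1).2) ∈ Φ.target
    rw [← h0]
    exact Φ.map_source hu
  map_target' w hw := by
    change ((0 : P.relations), w) ∈ Φ.target at hw
    simp [hw, Φ.map_target hw]
  left_inv' u hu := by
    have h0 : (Φ u.1).1 = 0 := (hΦ.fst_eq _ hu).trans ((P.mem_realMomentAngle_iff _).1 u.2)
    have h1 : ((0 : P.relations), (Φ u.1).2) = Φ u.1 := by rw [← h0]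
    have hu' : u.1 ∈ Φ.source := hu
    apply Subtype.ext
    simp only [h1]
    rw [dif_pos (Φ.map_source hu)]
    exact Φ.left_inv hu
  right_inv' w hw := by
    change ((0 : P.relations), w) ∈ Φ.target at hw
    simp [hw, Φ.right_inv hw]
  open_source := Φ.open_source.preimage continuous_subtype_val
  open_target := Φ.open_target.preimage (by fun_prop)
  continuousOn_toFun := by
    refine continuous_snd.comp_continuousOn ?_
    exact Φ.continuousOn.comp continuous_subtype_val.continuousOn fun _ hu => hu
  continuousOn_invFun := by
    rw [Topology.IsInducing.subtypeVal.continuousOn_iff]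
    have h : ContinuousOn (fun w => Φ.symm ((0 : P.relations), w))
        {w | ((0 : P.relations), w) ∈ Φ.target} :=
      Φ.continuousOn_symm.comp (by fun_prop) fun w hw => hw
    refine h.congr fun w hw => ?_
    change ((0 : P.relations), w) ∈ Φ.target at hw
    simp [hw]

/-- A choice of straightening coordinates around a point of `ℛ_P`. -/
noncomputable def straightening [P.IsGeneric] (u : P.realMomentAngle) :=
  (P.exists_isStraightening u).choose

theorem straightening_spec [P.IsGeneric] (u : P.realMomentAngle) :
    P.IsStraightening (P.straightening u) ∧ u.1 ∈ (P.straightening u).source :=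
  (P.exists_isStraightening u).choose_spec

/-- The smooth structure on `ℛ_P` as a submanifold of `ℝᵐ`: the atlas consists of all slice charts. -/
noncomputable instance realMomentAngleChartedSpace [P.IsGeneric] :
    ChartedSpace (EuclideanSpace ℝ (Fin n)) P.realMomentAngle where
  atlas := {φ | ∃ u₀ Φ hΦ, φ = P.sliceChart u₀ Φ hΦ}
  chartAt u := P.sliceChart u (P.straightening u) (P.straightening_spec u).1
  mem_chart_source u := (P.straightening_spec u).2
  chart_mem_atlas _ := ⟨_, _, _, rfl⟩

instance realMomentAngleIsManifold [P.IsGeneric] :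
    IsManifold 𝓘(ℝ, EuclideanSpace ℝ (Fin n)) ∞ P.realMomentAngle := by
  apply isManifold_of_contDiffOn
  rintro _ _ ⟨u, Φ, hΦ, rfl⟩ ⟨u', Φ', hΦ', rfl⟩
  have h1 : ContDiffOn ℝ ω (fun w => (Φ' (Φ.symm ((0 : P.relations), w))).2)
      {w | ((0 : P.relations), w) ∈ Φ.target ∧ Φ.symm ((0 : P.relations), w) ∈ Φ'.source} := by
    refine contDiff_snd.comp_contDiffOn (hΦ'.contDiffOn.comp ?_ fun w hw => hw.2)
    exact hΦ.contDiffOn_symm.comp (by fun_prop) fun w hw => hw.1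
  refine ((h1.of_le (by simp : (∞ : WithTop ℕ∞) ≤ ω)).congr ?_).mono ?_
  · rintro w ⟨hw, -⟩
    simp [sliceChart, hw]
  · rintro w ⟨hw, -⟩
    simp only [Set.mem_preimage, OpenPartialHomeomorph.trans_source,
      OpenPartialHomeomorph.symm_source] at hw
    have hw1 : ((0 : P.relations), w) ∈ Φ.target := hw.1
    have hw2 := hw.2
    simp [sliceChart, hw1] at hw2
    exact ⟨hw1, hw2⟩

theorem realMomentAngle_coe_contMDiff [P.IsGeneric] :
    ContMDiff 𝓘(ℝ, EuclideanSpace ℝ (Fin n)) 𝓘(ℝ, EuclideanSpace ℝ (Fin m)) ∞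
      (Subtype.val : P.realMomentAngle → EuclideanSpace ℝ (Fin m)) := by
  intro u
  rw [contMDiffAt_iff]
  refine ⟨continuous_subtype_val.continuousAt, ?_⟩
  obtain ⟨hΦ, hu⟩ := P.straightening_spec u
  set Φ := P.straightening u
  have h0 : (Φ u.1).1 = 0 := (hΦ.fst_eq _ hu).trans ((P.mem_realMomentAngle_iff _).1 u.2)
  have h1 : ((0 : P.relations), (Φ u.1).2) = Φ u.1 := by rw [← h0]
  have hch : chartAt (EuclideanSpace ℝ (Fin n)) u = P.sliceChart u Φ hΦ := rfl
  have hopen : IsOpen {w | ((0 : P.relations), w) ∈ Φ.target} :=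
    Φ.open_target.preimage (by fun_prop)
  have h2 : ContDiffOn ℝ ω (fun w => Φ.symm ((0 : P.relations), w))
      {w | ((0 : P.relations), w) ∈ Φ.target} :=
    hΦ.contDiffOn_symm.comp (by fun_prop) fun w hw => hw
  have hmem : (Φ u.1).2 ∈ {w | ((0 : P.relations), w) ∈ Φ.target} := by
    change ((0 : P.relations), (Φ u.1).2) ∈ Φ.target
    rw [h1]; exact Φ.map_source hu
  have h3 := (h2.of_le (by simp : (∞ : WithTop ℕ∞) ≤ ω)).contDiffAt (hopen.mem_nhds hmem)
  have he : extChartAt 𝓘(ℝ, EuclideanSpace ℝ (Fin n)) u u = (Φ u.1).2 := rfl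
  rw [he]
  refine (h3.congr_of_eventuallyEq ?_).contDiffWithinAt
  filter_upwards [hopen.mem_nhds hmem] with w hw
  change ((0 : P.relations), w) ∈ Φ.target at hw
  simp only [Function.comp_apply, extChartAt_model_space_eq_id, PartialEquiv.refl_coe, id_eq]
  simp [extChartAt, hch, sliceChart, hw]

theorem contMDiff_of_coe [P.IsGeneric] {E H X : Type*} [NormedAddCommGroup E] [NormedSpace ℝ E]
    [TopologicalSpace H] {I : ModelWithCorners ℝ E H} [TopologicalSpace X] [ChartedSpace H X]
    {f : X → P.realMomentAngle}
    (hf : ContMDiff I 𝓘(ℝ, EuclideanSpace ℝ (Fin m)) ∞ fun x => (f x).1) :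
    ContMDiff I 𝓘(ℝ, EuclideanSpace ℝ (Fin n)) ∞ f := by
  have hc : Continuous f := continuous_induced_rng.2 hf.continuous
  intro x
  rw [contMDiffAt_iff_target]
  refine ⟨hc.continuousAt, ?_⟩
  obtain ⟨hΦ, hu⟩ := P.straightening_spec (f x)
  set Φ := P.straightening (f x)
  have h1 := (hΦ.contDiffOn.of_le (by simp : (∞ : WithTop ℕ∞) ≤ ω)).contDiffAt
    (Φ.open_source.mem_nhds hu)
  have h2 : ContDiffAt ℝ ∞ (fun v => (Φ v).2) (f x).1 := contDiff_snd.contDiffAt.comp _ h1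
  exact ContMDiffAt.comp (I' := 𝓘(ℝ, EuclideanSpace ℝ (Fin m))) (g := fun v => (Φ v).2)
    (f := fun y => (f y).1) x h2.contMDiffAt (hf x)

theorem relationsExp_add (χ ψ : P.relations) :
    P.relationsExp (χ + ψ) = P.relationsExp χ * P.relationsExp ψ :=
  Subtype.ext (torusExp_add χ.1 ψ.1)

theorem relationsExp_deck (χ ψ : P.relations) (h : P.relationsExp χ = P.relationsExp ψ) :
    ∃ f : P.relations → P.relations, ContMDiff 𝓘(ℝ, P.relations) 𝓘(ℝ, P.relations) ∞ f ∧
      f χ = ψ ∧ P.relationsExp ∘ f = P.relationsExp := by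
  refine ⟨fun ξ => ξ + (ψ - χ), (contDiff_id.add contDiff_const).contMDiff, by simp, ?_⟩
  have h1 : P.relationsExp (ψ - χ) = 1 := by
    have := P.relationsExp_add (ψ - χ) χ
    rw [sub_add_cancel, ← h] at this
    exact (mul_eq_right.1 this.symm)
  funext ξ
  simp [relationsExp_add, h1]

instance torusIsManifold [P.IsRational] : IsManifold 𝓘(ℝ, P.relations) ∞ P.torus :=
  pushforward_isManifold 𝓘(ℝ, P.relations) ∞ P.relationsExp_isLocalHomeomorph
    P.relationsExp_surjective P.relationsExp_deck

theorem relationsExp_contMDiff [P.IsRational] :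
    ContMDiff 𝓘(ℝ, P.relations) 𝓘(ℝ, P.relations) ∞ P.relationsExp :=
  pushforward_contMDiff 𝓘(ℝ, P.relations) ∞ P.relationsExp_isLocalHomeomorph
    P.relationsExp_surjective P.relationsExp_deck

theorem torus_mul_contMDiff [P.IsRational] (t : P.torus) :
    ContMDiff 𝓘(ℝ, P.relations) 𝓘(ℝ, P.relations) ∞ fun s : P.torus => t * s := by
  refine pushforward_contMDiff_of_comp 𝓘(ℝ, P.relations) ∞ P.relationsExp_isLocalHomeomorph
    P.relationsExp_surjective (g := fun s : P.torus => t * s) ?_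
  obtain ⟨χ, rfl⟩ := P.relationsExp_surjective t
  have : (fun s => P.relationsExp χ * s) ∘ P.relationsExp =
      P.relationsExp ∘ fun ψ => χ + ψ := by
    funext ψ
    simp [relationsExp_add]
  rw [this]
  exact P.relationsExp_contMDiff.comp (contDiff_const.add contDiff_id).contMDiff

theorem realMomentAngle_smul_contMDiff [P.IsGeneric] (g : P.signGroup) :
    ContMDiff 𝓘(ℝ, EuclideanSpace ℝ (Fin n)) 𝓘(ℝ, EuclideanSpace ℝ (Fin n)) ∞
      fun u : P.realMomentAngle => g • u := by
  apply P.contMDiff_of_coe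
  have h : ContDiff ℝ ∞ fun u : EuclideanSpace ℝ (Fin m) =>
      (WithLp.toLp 2 fun k => (P.sgn g k : ℂ).re * u k : EuclideanSpace ℝ (Fin m)) :=
    (PiLp.contDiff_toLp).comp (contDiff_pi.2 fun k => by fun_prop)
  exact h.contMDiff.comp P.realMomentAngle_coe_contMDiff

/-! ### The smooth structure on `N_P` -/

instance realMomentAngleLocallyCompactSpace [P.IsGeneric] :
    LocallyCompactSpace P.realMomentAngle :=
  ChartedSpace.locallyCompactSpace (EuclideanSpace ℝ (Fin n)) P.realMomentAngle

instance torusLocallyCompactSpace [P.IsRational] :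
    LocallyCompactSpace P.torus :=
  ChartedSpace.locallyCompactSpace P.relations P.torus

/-- The model `ℝⁿ × K` (of dimension `m`) of the product manifold `ℛ_P × T_P`. -/
noncomputable abbrev model : ModelWithCorners ℝ (EuclideanSpace ℝ (Fin n) × P.relations)
    (ModelProd (EuclideanSpace ℝ (Fin n)) P.relations) :=
  𝓘(ℝ, EuclideanSpace ℝ (Fin n)).prod 𝓘(ℝ, P.relations)

/-- The smooth structure on `N_P`: the charts are those of `ℛ_P × T_P` composed with local inverses of
the quotient map `ℛ_P × T_P → N_P` by the free action of the finite group `D_P`. -/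
noncomputable instance quotientSpaceChartedSpace [P.IsGeneric] [P.IsRational] :
    ChartedSpace (ModelProd (EuclideanSpace ℝ (Fin n)) P.relations) P.quotientSpace :=
  MulAction.instChartedSpaceQuotient

theorem quotient_deck [P.IsGeneric] [P.IsRational] (x y : P.realMomentAngle × P.torus)
    (h : (Quotient.mk _ x : P.quotientSpace) = Quotient.mk _ y) :
    ∃ f : P.realMomentAngle × P.torus → P.realMomentAngle × P.torus,
      ContMDiff P.model P.model ∞ f ∧ f x = y ∧
      (Quotient.mk _ : _ → P.quotientSpace) ∘ f = Quotient.mk _ := by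
  obtain ⟨g, hg⟩ := Quotient.exact h.symm
  refine ⟨fun z => g • z, ?_, hg, ?_⟩
  · have h1 := (P.realMomentAngle_smul_contMDiff g).comp
      (contMDiff_fst (I := 𝓘(ℝ, EuclideanSpace ℝ (Fin n))) (J := 𝓘(ℝ, P.relations))
        (M := P.realMomentAngle) (N := P.torus))
    have h2 := (P.torus_mul_contMDiff (g : P.torus)).comp
      (contMDiff_snd (I := 𝓘(ℝ, EuclideanSpace ℝ (Fin n))) (J := 𝓘(ℝ, P.relations))
        (M := P.realMomentAngle) (N := P.torus))
    exact h1.prodMk h2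
  · funext z
    exact Quotient.sound ⟨g, rfl⟩

instance quotientSpaceIsManifold [P.IsGeneric] [P.IsRational] :
    IsManifold P.model ∞ P.quotientSpace :=
  pushforward_isManifold P.model ∞
    isQuotientCoveringMap_quotientMk_of_properlyDiscontinuousSMul.isCoveringMap.isLocalHomeomorph
    Quotient.mk_surjective P.quotient_deck

end PolyhedronPresentation

open scoped ContDiff Manifold Topology

namespace PolyhedronPresentation

variable {n m : ℕ} (P : PolyhedronPresentation n m)

/-! ### Delzant presentations and the stabilizers of the action of `T_P` -/

/-! For every generic rational presentation the map `N_P → ℂᵐ` is an immersion and a closed map, so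
the whole question is whether it is injective. This is decided by the stabilizers of `T_P`, through
the condition `HasTrivialStabilizers`.

Injectivity and stabilizers: if `(u, t)` and `(u', t')` have the same image, comparing moduli gives
`u k = ± u' k`, so `(t / t') ^ 2` is `1` in every coordinate with `u' k ≠ 0`. Trivial stabilizers
make it `1` everywhere, and then `t / t' ∈ D_P` identifies the two pairs. Conversely, a nontrivial
stabilizing element has a square root in `T_P`, and this root produces two distinct points of `N_P`
with the same image (`hasTrivialStabilizers_of_injective`).

Stabilizers and Delzant: trivial stabilizers at `x` mean that a real combination of the normals
active at `x` lies in `Λ` only if its coefficients are integers. This holds exactly when the active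
normals span a direct summand of `Λ`, that is, extend to a `ℤ`-basis.

Topology: `T_P` is compact and `|u k * t k| = |u k|`, so the map is proper even when `P` is
unbounded.

Immersion: the radial and angular parts of the derivative of `u k * t k` are orthogonal. A kernel
vector `(v, τ)` therefore has no radial part, whence `v = 0`, and satisfies `u k * τ k = 0` for all
`k`. So `τ` is a linear relation among the normals active at the point, which are independent, and
`τ = 0`. -/

/-- An element of `T_P` all of whose coordinates are `1` except at hyperplanes through a common
point of the polyhedron is trivial. Equivalently, `T_P` acts freely on the moment-angle manifold. -/
def HasTrivialStabilizers : Prop :=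
  ∀ x ∈ P.polyhedron, ∀ t ∈ P.torus, (∀ k, P.slack x k ≠ 0 → t k = 1) → t = 1

theorem torusExp_apply_eq_one_iff {χ : EuclideanSpace ℝ (Fin m)} {k : Fin m} :
    torusExp χ k = 1 ↔ ∃ z : ℤ, χ k = z := by
  rw [show torusExp χ k = Circle.exp (2 * Real.pi * χ k) from rfl, Circle.exp_eq_one]
  refine exists_congr fun z => ?_
  rw [mul_comm (z : ℝ), mul_right_inj' Real.two_pi_pos.ne']

theorem normal_mem_lattice (k : Fin m) : P.normal k ∈ P.lattice :=
  Submodule.subset_span ⟨k, rfl⟩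

theorem span_range_normal [P.IsGeneric] : Submodule.span ℝ (Set.range P.normal) = ⊤ := by
  rw [eq_top_iff]
  rintro y -
  obtain ⟨χ, rfl⟩ := P.normalSum_surjective y
  change ∑ k, χ k • P.normal k ∈ _
  exact sum_mem fun k _ => Submodule.smul_mem _ _ (Submodule.subset_span (Set.mem_range_self k))

instance latticeDiscreteTopology [hr : P.IsRational] : DiscreteTopology P.lattice := hr.discrete

/-- Full rank lets a `ℤ`-basis of `Λ` serve as an `ℝ`-basis of `ℝⁿ`. It rests on the existence of a
vertex, through `normalSum_surjective`. -/
instance latticeIsZLattice [P.IsGeneric] [P.IsRational] : IsZLattice ℝ P.lattice where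
  span_top := by
    rw [eq_top_iff, ← P.span_range_normal]
    exact Submodule.span_mono (by rintro _ ⟨k, rfl⟩; exact P.normal_mem_lattice k)

/-- Apply to `∑ j, χ j • a j ∈ Λ` the coordinate functional dual to the basis vector `a k`. The
other active normals contribute `0` and the inactive ones contribute integers, so `χ k` itself is an
integer. -/
theorem IsDelzant.hasTrivialStabilizers [P.IsGeneric] [P.IsRational] (h : P.IsDelzant) :
    P.HasTrivialStabilizers := by
  rintro x hx _ ⟨χ, hχ, rfl⟩ ht
  obtain ⟨r, β, e, he⟩ := h.part_of_basis x hx (Finset.univ.filter fun k => P.slack x k = 0)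
    (by simp)
  have hint : ∀ k, P.slack x k ≠ 0 → ∃ z : ℤ, χ k = z :=
    fun k hk => torusExp_apply_eq_one_iff.1 (ht k hk)
  -- The same basis over `ℝ`: its coordinates apply to real combinations and take integer values on
  -- `Λ`.
  let B := β.ofZLatticeBasis ℝ P.lattice
  have hB : ∀ y ∈ P.lattice, ∀ i, ∃ z : ℤ, B.repr y i = z := fun y hy i =>
    ⟨β.repr ⟨y, hy⟩ i, β.ofZLatticeBasis_repr_apply ℝ P.lattice ⟨y, hy⟩ i⟩
  funext k
  rw [Pi.one_apply]
  by_cases hk : P.slack x k = 0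
  swap
  · exact ht k hk
  rw [torusExp_apply_eq_one_iff]
  let k' : {j // j ∈ Finset.univ.filter fun k => P.slack x k = 0} := ⟨k, by simpa using hk⟩
  have hrepr : ∀ j : {j // j ∈ Finset.univ.filter fun k => P.slack x k = 0},
      B.repr (P.normal j) (e k') = if j = k' then 1 else 0 := by
    intro j
    have : P.normal j = B (e j) := by
      rw [← he j]; exact (β.ofZLatticeBasis_apply ℝ P.lattice (e j)).symm
    rw [this, B.repr_self, Finsupp.single_apply]
    simp
  have hsum : B.repr (P.normalSum χ) (e k') = ∑ j, χ j * B.repr (P.normal j) (e k') := by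
    change B.repr (∑ j, χ j • P.normal j) (e k') = _
    simp
  have hterm : ∀ j ∈ Finset.univ.erase k, ∃ z : ℤ, χ j * B.repr (P.normal j) (e k') = z := by
    intro j hj
    by_cases hj0 : P.slack x j = 0
    · have := hrepr ⟨j, by simpa using hj0⟩
      rw [if_neg (by simp only [k', Subtype.mk.injEq]; exact Finset.ne_of_mem_erase hj)] at this
      exact ⟨0, by simp [this]⟩
    · obtain ⟨z, hz⟩ := hint j hj0
      obtain ⟨w, hw⟩ := hB _ (P.normal_mem_lattice j) (e k')
      exact ⟨z * w, by rw [hz, hw]; push_cast; rfl⟩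
  choose! z hz using hterm
  obtain ⟨w, hw⟩ := hB _ hχ (e k')
  rw [hsum, ← Finset.add_sum_erase _ _ (Finset.mem_univ k), Finset.sum_congr rfl hz] at hw
  have := hrepr k'
  rw [if_pos rfl] at this
  rw [show P.normal k = P.normal k' from rfl, this, mul_one] at hw
  exact ⟨w - ∑ j ∈ Finset.univ.erase k, z j, by push_cast; linarith⟩

/-- The span `S` of all normals active at `x` has torsion-free quotient `Λ / S`. This quotient is
then free, and lifting a basis of it completes the active normals to a basis of `Λ`; the indices in
`J` are among them. -/
theorem HasTrivialStabilizers.isDelzant [hg : P.IsGeneric] [hr : P.IsRational]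
    (h : P.HasTrivialStabilizers) : P.IsDelzant := by
  refine ⟨hr, fun x hx J hJ => ?_⟩
  let I := {k : Fin m // P.slack x k = 0}
  let v : I → P.lattice := fun i => ⟨P.normal i, P.normal_mem_lattice i⟩
  -- Extending the coefficients by zero to the inactive indices gives an element of `T_P` that is
  -- `1` at those indices.
  have hint : ∀ c : I → ℝ, ∑ i, c i • P.normal i ∈ P.lattice → ∀ i, ∃ z : ℤ, c i = z := by
    intro c hc i
    let χ : EuclideanSpace ℝ (Fin m) :=
      WithLp.toLp 2 fun k => if hk : P.slack x k = 0 then c ⟨k, hk⟩ else 0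
    have hχ : P.normalSum χ = ∑ i, c i • P.normal i := by
      change ∑ k, χ k • P.normal k = _
      rw [← Fintype.sum_subtype_add_sum_subtype (fun k => P.slack x k = 0)]
      rw [Finset.sum_eq_zero (s := (Finset.univ : Finset {k // ¬ P.slack x k = 0}))
        fun k _ => by simp [χ, k.2], add_zero]
      refine Finset.sum_congr rfl fun i _ => ?_
      simp only [χ, dif_pos i.2]
    have h1 := h x hx (torusExp χ) ⟨χ, hχ ▸ hc, rfl⟩ fun k hk =>
      torusExp_apply_eq_one_iff.2 ⟨0, by simp [χ, hk]⟩
    obtain ⟨z, hz⟩ := torusExp_apply_eq_one_iff.1 (congrFun h1 i.1)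
    exact ⟨z, by rw [← hz]; simp only [χ, dif_pos i.2]; rfl⟩
  have hli : LinearIndependent ℤ v := by
    refine LinearIndependent.of_comp P.lattice.subtype ?_
    exact (hg.general_position x hx).restrict_scalars fun a b hab => by simpa using hab
  let S := Submodule.span ℤ (Set.range v)
  have htf : Module.IsTorsionFree ℤ (P.lattice ⧸ S) := by
    -- If `r • y = ∑ c i • a i` with `r ≠ 0`, then `y` has real coefficients `c i / r`, which `hint`
    -- forces to be integers, so `y ∈ S`.
    refine Module.IsTorsionFree.of_smul_eq_zero fun r q hq => or_iff_not_imp_left.2 fun hr0 => ?_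
    obtain ⟨y, rfl⟩ := Submodule.Quotient.mk_surjective S q
    rw [← Submodule.Quotient.mk_smul, Submodule.Quotient.mk_eq_zero,
      Submodule.mem_span_range_iff_exists_fun] at hq
    obtain ⟨c, hc⟩ := hq
    have hr0' : (r : ℝ) ≠ 0 := Int.cast_ne_zero.2 hr0
    have hc' : ∑ i, (c i : ℝ) • P.normal i = (r : ℝ) • (y : EuclideanSpace ℝ (Fin n)) := by
      simpa [v, Int.cast_smul_eq_zsmul] using congrArg Subtype.val hc
    have hy : ∑ i, ((c i : ℝ) / r) • P.normal i = (y : EuclideanSpace ℝ (Fin n)) := by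
      simp only [div_eq_inv_mul, mul_smul, ← Finset.smul_sum]
      rw [hc', inv_smul_smul₀ hr0']
    choose z hz using hint (fun i => (c i : ℝ) / r) (hy ▸ y.2)
    rw [Submodule.Quotient.mk_eq_zero, Submodule.mem_span_range_iff_exists_fun]
    refine ⟨z, Subtype.ext ?_⟩
    rw [← hy]
    simp [v, hz, Int.cast_smul_eq_zsmul]
  have : Module.Finite ℤ P.lattice := inferInstance
  have : Module.Free ℤ (P.lattice ⧸ S) := inferInstance
  let b := (Module.Basis.span hli).sumQuot (Module.finBasis ℤ (P.lattice ⧸ S))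
  let ε := Fintype.equivFin (I ⊕ Fin (Module.finrank ℤ (P.lattice ⧸ S)))
  refine ⟨_, b.reindex ε, ⟨fun j => ε (Sum.inl ⟨j, hJ j j.2⟩), fun i j hij => ?_⟩, fun j => ?_⟩
  · have := Sum.inl_injective (ε.injective hij)
    exact Subtype.ext (congrArg (fun k : I => k.1) this)
  · change ((b.reindex ε (ε (Sum.inl ⟨j, hJ j j.2⟩)) : P.lattice) : EuclideanSpace ℝ (Fin n)) = _
    rw [Module.Basis.reindex_apply, Equiv.symm_apply_apply, Module.Basis.sumQuot_inl,
      Module.Basis.span_apply]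

end PolyhedronPresentation

namespace PolyhedronPresentation

variable {n m : ℕ} (P : PolyhedronPresentation n m)

/-! ### Injectivity of `N_P → ℂᵐ` -/

theorem coverMap_apply (p : P.realMomentAngle × P.torus) (k : Fin m) :
    P.coverMap p k = (p.1.1 k : ℂ) * (p.2.1 k : ℂ) := rfl

theorem HasTrivialStabilizers.quotientMap_injective (h : P.HasTrivialStabilizers) :
    Function.Injective P.quotientMap := by
  intro p q
  induction p using Quotient.inductionOn with | _ p
  induction q using Quotient.inductionOn with | _ q
  intro hpq
  have hpq' : ∀ k, (p.1.1 k : ℂ) * (p.2.1 k : ℂ) = (q.1.1 k : ℂ) * (q.2.1 k : ℂ) := fun k =>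
    congrArg (fun z : EuclideanSpace ℂ (Fin m) => z k) hpq
  obtain ⟨x, hx, hux⟩ := q.1.2
  -- Only the square is known to be `1` where `u k ≠ 0`, since `u` is determined only up to signs;
  -- its triviality says that `p.2 / q.2` lies in `D_P`.
  have hg : (p.2 / q.2) ^ 2 = 1 := by
    refine Subtype.ext (h x hx _ ((p.2 / q.2) ^ 2).2 fun k hk => ?_)
    have hq0 : q.1.1 k ≠ 0 := by
      intro h0
      rw [← hux k, h0] at hk
      simp at hk
    have hnorm := congrArg norm (hpq' k)
    simp only [norm_mul, Circle.norm_coe, mul_one, Complex.norm_real] at hnorm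
    have hsq : ((p.1.1 k : ℂ)) ^ 2 = (q.1.1 k : ℂ) ^ 2 := by
      have := (sq_eq_sq_iff_abs_eq_abs _ _).2 hnorm
      exact_mod_cast this
    have hq0' : (q.1.1 k : ℂ) ^ 2 ≠ 0 := pow_ne_zero _ (Complex.ofReal_ne_zero.2 hq0)
    have h2 := congrArg (fun z : ℂ => z ^ 2) (hpq' k)
    simp only [mul_pow, hsq] at h2
    have h3 := mul_left_cancel₀ hq0' h2
    change (p.2.1 k / q.2.1 k) ^ 2 = 1
    rw [div_pow, div_eq_one]
    exact Circle.ext (by simpa using h3)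
  refine Quotient.sound ⟨⟨p.2 / q.2, hg⟩, ?_⟩
  have hgk : ∀ k, ((p.2.1 k : ℂ) / q.2.1 k) ^ 2 = 1 := fun k => by
    have := congrArg (fun t : P.torus => ((t.1 k : Circle) : ℂ)) hg
    simpa using this
  refine Prod.ext (Subtype.ext ?_) (div_mul_cancel p.2 q.2)
  ext k
  apply Complex.ofReal_injective
  refine (P.smul_coe _ _ k).trans ?_
  have e : (P.sgn ⟨p.2 / q.2, hg⟩ k : ℂ) = (p.2.1 k : ℂ) / q.2.1 k := by
    simp [sgn]
  have hp0 := Circle.coe_ne_zero (p.2.1 k)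
  have hq0 := Circle.coe_ne_zero (q.2.1 k)
  have h1 := hgk k
  rw [e]
  rw [div_pow, div_eq_one_iff_eq (pow_ne_zero _ hq0)] at h1
  have h2 := hpq' k
  rw [div_mul_eq_mul_div, div_eq_iff hq0]
  apply mul_right_cancel₀ hq0
  linear_combination (p.1.1 k : ℂ) * h1 - (p.2.1 k : ℂ) * h2

/-- Comparing `(u, t)` with `(u, 1)` would give only `t ∈ D_P`, that is, `t ^ 2 = 1`. Using a square
root `g` of `t` instead yields `g ∈ D_P`, hence `t = g ^ 2 = 1`. -/
theorem hasTrivialStabilizers_of_injective (h : Function.Injective P.quotientMap) :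
    P.HasTrivialStabilizers := by
  intro x hx t ht htk
  obtain ⟨ψ, hψ⟩ := P.relationsExp_surjective ⟨t, ht⟩
  -- The square root comes from halving a lift of `t` to the vector space `K`.
  set g := P.relationsExp ((2⁻¹ : ℝ) • ψ)
  have hgg : g * g = ⟨t, ht⟩ := by
    rw [← P.relationsExp_add, ← add_smul, ← hψ]
    norm_num
  have hggk : ∀ k, g.1 k * g.1 k = t k := fun k =>
    congrArg (fun s : P.torus => s.1 k) hgg
  have hre : ∀ k, P.slack x k ≠ 0 → (g.1 k : ℂ) = 1 ∨ (g.1 k : ℂ) = -1 := by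
    intro k hk
    have := (hggk k).trans (htk k hk)
    refine mul_self_eq_one_iff.1 ?_
    rw [← Circle.coe_mul, this, Circle.coe_one]
  let u : P.realMomentAngle := ⟨WithLp.toLp 2 fun k => √(P.slack x k), x, hx, fun k =>
    Real.sq_sqrt (hx k)⟩
  -- The signs of `g` cancel in `u' * g`. Where the slack vanishes, `g k` need not be `±1`, but
  -- there the coordinate is `0`.
  let u' : P.realMomentAngle :=
    ⟨WithLp.toLp 2 fun k => √(P.slack x k) * (g.1 k : ℂ).re, x, hx, fun k => by
      simp only
      rw [mul_pow, Real.sq_sqrt (hx k)]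
      by_cases hk : P.slack x k = 0
      · simp [hk]
      · rcases hre k hk with h | h <;> simp [h]⟩
  have hmap : P.quotientMap (Quotient.mk _ (u', g)) = P.quotientMap (Quotient.mk _ (u, 1)) := by
    change P.coverMap (u', g) = P.coverMap (u, 1)
    ext k
    simp only [coverMap_apply, u, u']
    by_cases hk : P.slack x k = 0
    · simp [hk]
    · rcases hre k hk with h | h <;> simp [h]
  obtain ⟨d, hd⟩ := Quotient.exact (h hmap)
  have hdg : (d : P.torus) = g := by
    have : (d : P.torus) * 1 = g := congrArg Prod.snd hd
    rwa [mul_one] at this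
  have h1 : g * g = 1 := by
    have : (d : P.torus) ^ 2 = 1 := d.2
    rwa [hdg, sq] at this
  exact congrArg Subtype.val (hgg.symm.trans h1)

/-! ### The topology of `N_P → ℂᵐ` -/

theorem torusExp_surjective : Function.Surjective (torusExp : EuclideanSpace ℝ (Fin m) → _) := by
  intro t
  refine ⟨WithLp.toLp 2 fun k => (2 * Real.pi)⁻¹ * Complex.arg (t k), ?_⟩
  funext k
  simp only [torusExp]
  rw [mul_inv_cancel_left₀ Real.two_pi_pos.ne', Circle.exp_arg]

theorem torusExp_preimage_torus :
    torusExp ⁻¹' (P.torus : Set (Fin m → Circle)) = P.normalSum ⁻¹' P.lattice := by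
  ext χ
  refine ⟨?_, fun h => ⟨χ, h, rfl⟩⟩
  rintro ⟨ψ, hψ, h⟩
  have := add_mem (P.normalSum_sub_mem h.symm) hψ
  rwa [sub_add_cancel] at this

/-- Closedness can be tested upstairs in `ℝᵐ`, where the preimage of `T_P` is the preimage of the
discrete, hence closed, group `Λ` under a linear map. -/
theorem isClosed_torus [P.IsRational] : IsClosed (P.torus : Set (Fin m → Circle)) := by
  have hq := torusExp_isLocalHomeomorph (m := m)
  rw [← (hq.isOpenMap.isQuotientMap hq.continuous torusExp_surjective).isClosed_preimage,
    torusExp_preimage_torus]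
  have hΛ : IsClosed (P.lattice : Set (EuclideanSpace ℝ (Fin n))) :=
    have : DiscreteTopology P.lattice.toAddSubgroup := P.latticeDiscreteTopology
    AddSubgroup.isClosed_of_discrete (H := P.lattice.toAddSubgroup)
  exact hΛ.preimage P.normalSum.continuous_of_finiteDimensional

instance torusCompactSpace [P.IsRational] : CompactSpace P.torus :=
  isCompact_iff_compactSpace.1 P.isClosed_torus.isCompact

theorem isClosed_realMomentAngle : IsClosed P.realMomentAngle := by
  have : P.realMomentAngle = P.quadrics ⁻¹' {0} := by
    ext u
    exact P.mem_realMomentAngle_iff u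
  rw [this]
  exact isClosed_singleton.preimage P.quadrics_contDiff.continuous

theorem norm_coverMap (p : P.realMomentAngle × P.torus) : ‖P.coverMap p‖ = ‖p.1.1‖ := by
  simp only [EuclideanSpace.norm_eq, coverMap_apply, norm_mul, Circle.norm_coe, mul_one,
    Complex.norm_real]

theorem continuous_coverMap : Continuous P.coverMap := by
  refine (PiLp.continuous_toLp 2 _).comp (continuous_pi fun k => ?_)
  have h : Continuous fun p : P.realMomentAngle × P.torus => p.2.1 k :=
    (continuous_apply k).comp (continuous_subtype_val.comp continuous_snd)
  have h' : Continuous fun p : P.realMomentAngle × P.torus => p.1.1 k := by fun_prop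
  exact (Complex.continuous_ofReal.comp h').mul (continuous_subtype_val.comp h)

/-- The map preserves norms, so the preimage of a compact set is closed in the product of a bounded
closed part of `ℛ_P` and the compact `T_P`: the map is proper. -/
theorem isClosedMap_coverMap [P.IsRational] : IsClosedMap P.coverMap := by
  refine IsProperMap.isClosedMap (isProperMap_iff_isCompact_preimage.2
    ⟨P.continuous_coverMap, fun K hK => ?_⟩)
  obtain ⟨C, hC⟩ := hK.isBounded.exists_norm_le
  have h1 : IsCompact (Subtype.val ⁻¹' Metric.closedBall 0 C : Set P.realMomentAngle) :=
    P.isClosed_realMomentAngle.isClosedEmbedding_subtypeVal.isCompact_preimage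
      (isCompact_closedBall 0 C)
  refine (h1.prod (isCompact_univ : IsCompact (Set.univ : Set P.torus))).of_isClosed_subset
    (hK.isClosed.preimage P.continuous_coverMap) fun p hp => ⟨?_, trivial⟩
  rw [Set.mem_preimage, mem_closedBall_zero_iff, ← norm_coverMap]
  exact hC _ hp

theorem continuous_quotientMap : Continuous P.quotientMap :=
  continuous_quot_lift _ P.continuous_coverMap

theorem isEmbedding_quotientMap [P.IsRational] (h : Function.Injective P.quotientMap) :
    Topology.IsEmbedding P.quotientMap :=
  (Topology.IsClosedEmbedding.of_continuous_injective_isClosedMap P.continuous_quotientMap h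
    (IsClosedMap.of_comp_surjective Quotient.mk_surjective continuous_quot_mk
      P.isClosedMap_coverMap)).isEmbedding

end PolyhedronPresentation

/-! ### Immersions of finite-dimensional manifolds -/

section Immersion

variable {E F V : Type*} [NormedAddCommGroup E] [NormedSpace ℝ E] [FiniteDimensional ℝ E]
  [NormedAddCommGroup F] [NormedSpace ℝ F] [FiniteDimensional ℝ F]
  [NormedAddCommGroup V] [NormedSpace ℝ V]

/-- An injective linear map extends to an isomorphism from the product with a space of complementary
dimension. -/
theorem ContinuousLinearMap.exists_coprod_equiv [FiniteDimensional ℝ V] {L : E →L[ℝ] V} (hL : Function.Injective L)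
    (hF : Module.finrank ℝ E + Module.finrank ℝ F = Module.finrank ℝ V) :
    ∃ (ι : F →L[ℝ] V) (A : (E × F) ≃L[ℝ] V), (A : E × F →L[ℝ] V) = L.coprod ι := by
  obtain ⟨Q, hQ⟩ := L.toLinearMap.range.exists_isCompl
  have h1 := Submodule.finrank_add_eq_of_isCompl hQ
  rw [LinearMap.finrank_range_of_inj hL] at h1
  let ε : F ≃L[ℝ] Q := ContinuousLinearEquiv.ofFinrankEq (by omega)
  let ι : F →L[ℝ] V := Q.subtypeL ∘L ε.toContinuousLinearMap
  have hinj : Function.Injective (L.coprod ι) := by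
    rw [injective_iff_map_eq_zero]
    rintro ⟨e, w⟩ h
    have h2 : L e + (ε w : V) = 0 := h
    have h3 : L e ∈ Q := by
      rw [eq_neg_of_add_eq_zero_left h2]
      exact neg_mem (ε w).2
    have h4 : L e = 0 := Submodule.disjoint_def.1 hQ.disjoint _ ⟨e, rfl⟩ h3
    rw [h4, zero_add] at h2
    have h5 : ε w = 0 := Subtype.ext h2
    rw [(injective_iff_map_eq_zero L).1 hL e h4, (map_eq_zero_iff ε ε.injective).1 h5]
    rfl
  refine ⟨ι, (LinearEquiv.ofInjectiveOfFinrankEq (L.coprod ι).toLinearMap hinj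
    (by simp [hF])).toContinuousLinearEquiv, ?_⟩
  ext <;> rfl

/-- The inverse function theorem in the smooth category. -/
theorem exists_openPartialHomeomorph_of_contDiffOn {G : E → V} {W : Set E} (hW : IsOpen W)
    (hG : ContDiffOn ℝ ∞ G W) {p : E} (hp : p ∈ W) {A : E ≃L[ℝ] V}
    (hA : HasFDerivAt G (A : E →L[ℝ] V) p) :
    ∃ Ψ : OpenPartialHomeomorph E V, p ∈ Ψ.source ∧ Ψ.source ⊆ W ∧ (Ψ : E → V) = G ∧
      ContDiffOn ℝ ∞ Ψ.symm Ψ.target := by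
  have : CompleteSpace E := FiniteDimensional.complete ℝ E
  have hGp : ContDiffAt ℝ ∞ G p := hG.contDiffAt (hW.mem_nhds hp)
  have h0 : (∞ : WithTop ℕ∞) ≠ 0 := by simp
  -- Invertibility of the derivative is an open condition. Restricting to where it holds makes the
  -- inverse smooth on the whole target, not just near the image of `p`.
  have hev : ∀ᶠ q in 𝓝 p, fderiv ℝ G q ∈ Set.range ((↑) : (E ≃L[ℝ] V) → E →L[ℝ] V) := by
    refine (hGp.fderiv_right (m := 0) (by simp)).continuousAt.eventually ?_
    rw [hA.fderiv]
    exact A.nhds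
  obtain ⟨O, hO, hOo, hpO⟩ := eventually_nhds_iff.1 (hev.and (hW.mem_nhds hp))
  let Ψ := (hGp.toOpenPartialHomeomorph G hA h0).restrOpen O hOo
  refine ⟨Ψ, ⟨hGp.mem_toOpenPartialHomeomorph_source hA h0, hpO⟩, fun q hq => (hO q hq.2).2, rfl,
    fun a ha => ?_⟩
  have hq : Ψ.symm a ∈ O := (Ψ.map_target ha).2
  obtain ⟨⟨e, he⟩, hqW⟩ := hO _ hq
  have hGq : ContDiffAt ℝ ∞ G (Ψ.symm a) := hG.contDiffAt (hW.mem_nhds hqW)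
  refine (Ψ.contDiffAt_symm (f₀' := e) ha ?_ hGq).contDiffWithinAt
  rw [he]
  exact (hGq.differentiableAt h0).hasFDerivAt

variable {H M : Type*} [TopologicalSpace H] {I : ModelWithCorners ℝ E H} [I.Boundaryless]
  [TopologicalSpace M] [ChartedSpace H M]

/-- A smooth map into a vector space whose derivative in a chart is injective is an immersion. -/
theorem Manifold.isImmersionAtOfComplement_of_fderiv_injective [FiniteDimensional ℝ V] {f : M → V} {x : M}
    {φ : OpenPartialHomeomorph M H} (hφ : φ ∈ IsManifold.maximalAtlas I ∞ M) (hx : x ∈ φ.source)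
    (hf : ContDiffOn ℝ ∞ (f ∘ (φ.extend I).symm) (φ.extend I).target)
    (hinj : Function.Injective (fderiv ℝ (f ∘ (φ.extend I).symm) (φ.extend I x)))
    (hF : Module.finrank ℝ E + Module.finrank ℝ F = Module.finrank ℝ V) :
    Manifold.IsImmersionAtOfComplement F I 𝓘(ℝ, V) ∞ f x := by
  obtain ⟨ι, A, hA⟩ := ContinuousLinearMap.exists_coprod_equiv hinj hF
  set g := f ∘ (φ.extend I).symm with hg
  have hU : IsOpen (φ.extend I).target := φ.isOpen_extend_target
  have hxU : φ.extend I x ∈ (φ.extend I).target :=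
    (φ.extend I).map_source (by rwa [φ.extend_source])
  have hfg : ∀ y ∈ φ.source, g (φ.extend I y) = f y := fun y hy => by
    simp only [hg, Function.comp_apply, φ.extend_left_inv hy]
  -- Thickening `g` by the complementary directions `ι` gives a map with invertible derivative `A`
  -- at the point, so it is a local diffeomorphism there.
  let G : E × F → V := fun p => g p.1 + ι p.2
  have hG0 : ∀ e, G (e, 0) = g e := fun e => by simp [G]
  have hG : ContDiffOn ℝ ∞ G ((φ.extend I).target ×ˢ Set.univ) :=
    (hf.comp contDiff_fst.contDiffOn fun p hp => hp.1).add
      (ι.contDiff.comp contDiff_snd).contDiffOn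
  have hGA : HasFDerivAt G (A : E × F →L[ℝ] V) (φ.extend I x, 0) := by
    have h1 : HasFDerivAt g (fderiv ℝ g (φ.extend I x)) ((φ.extend I x, (0 : F)).1) :=
      ((hf.contDiffAt (hU.mem_nhds hxU)).differentiableAt (by simp)).hasFDerivAt
    rw [hA]
    refine ((h1.comp _ hasFDerivAt_fst).add (ι.hasFDerivAt.comp _ hasFDerivAt_snd)).congr_fderiv ?_
    ext <;> simp
  obtain ⟨Ψ, hxΨ, hΨU, hΨG, hΨ⟩ := exists_openPartialHomeomorph_of_contDiffOn
    (hU.prod isOpen_univ) hG ⟨hxU, trivial⟩ hGA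
  -- The chart of `V` that undoes `G`, followed by `A` to return to `V`; in it `f` becomes `e ↦ A
  -- (e, 0)`.
  let ψ : OpenPartialHomeomorph V V := Ψ.symm.transHomeomorph A.toHomeomorph
  have hψ : ψ ∈ IsManifold.maximalAtlas 𝓘(ℝ, V) ∞ V := by
    refine StructureGroupoid.mem_maximalAtlas_of_mem_groupoid _ ?_
    rw [contDiffGroupoid, mem_groupoid_of_pregroupoid]
    have h1 : ContDiffOn ℝ ∞ ψ ψ.source := A.contDiff.comp_contDiffOn hΨ
    have h2 : ContDiffOn ℝ ∞ ψ.symm ψ.target := by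
      have : ContDiffOn ℝ ∞ Ψ Ψ.source := by rw [hΨG]; exact hG.mono hΨU
      exact this.comp A.symm.contDiff.contDiffOn fun y hy => hy
    simpa [contDiffPregroupoid] using And.intro h1 h2
  -- On `S` the map `f` factors through the source of `Ψ`, so it lands in the domain of `ψ`.
  let S : Set M := φ.source ∩ φ.extend I ⁻¹' {e | (e, (0 : F)) ∈ Ψ.source}
  have hS : IsOpen S := by
    have := φ.continuousOn_extend (I := I)
    rw [φ.extend_source] at this
    exact this.isOpen_inter_preimage φ.open_source (Ψ.open_source.preimage (by fun_prop))
  have hsrc : (φ.restr S).source = S := by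
    rw [φ.restr_source, hS.interior_eq]
    exact Set.inter_eq_right.2 Set.inter_subset_left
  have hfS : ∀ y ∈ S, f y = Ψ (φ.extend I y, 0) := fun y hy => by
    rw [hΨG, hG0, hfg y hy.1]
  have hmaps : ∀ y ∈ S, f y ∈ ψ.source := fun y hy => by
    rw [hfS y hy]
    exact Ψ.map_source hy.2
  refine .mk_of_charts A (φ.restr S) ψ (by rw [hsrc]; exact ⟨hx, hxΨ⟩) (hmaps x ⟨hx, hxΨ⟩)
    (restr_mem_maximalAtlas _ hφ hS) hψ (by rw [hsrc]; exact hmaps) fun e he => ?_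
  set y := ((φ.restr S).extend I).symm e with hy
  have hyS : y ∈ S := by
    have := ((φ.restr S).extend I).map_target he
    rwa [OpenPartialHomeomorph.extend_source, hsrc] at this
  have hye : φ.extend I y = e := ((φ.restr S).extend I).right_inv he
  change ψ (f y) = A (e, 0)
  rw [hfS y hyS, hye]
  change A (Ψ.symm (Ψ (e, 0))) = A (e, 0)
  rw [Ψ.left_inv (hye ▸ hyS.2)]

end Immersion

/-- If a product of a real function and a function with values in the unit circle has zero
derivative, then so has the real function, and so has the argument unless the product vanishes. -/
theorem hasDerivAt_zero_of_mul_circleExp {a b : ℝ → ℝ} {a' b' t : ℝ} (ha : HasDerivAt a a' t)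
    (hb : HasDerivAt b b' t) (h : HasDerivAt (fun s => (a s : ℂ) * Circle.exp (b s)) 0 t) :
    a' = 0 ∧ a t * b' = 0 := by
  have h1 : HasDerivAt (fun s => (a s : ℂ) * Circle.exp (b s))
      (a' * Complex.exp (b t * Complex.I) +
        a t * (Complex.exp (b t * Complex.I) * (b' * Complex.I))) t := by
    simp only [Circle.coe_exp]
    exact ha.ofReal_comp.mul (hb.ofReal_comp.mul_const Complex.I).cexp
  -- Factoring out the nonvanishing exponential separates the radial part `a'` from the angular part
  -- `a t * b'`, as real and imaginary parts.
  have h2 : ((a' : ℂ) + (a t * b' : ℝ) * Complex.I) * Complex.exp (b t * Complex.I) = 0 := by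
    rw [← h1.unique h]
    push_cast
    ring
  have h3 := (mul_eq_zero.1 h2).resolve_right (Complex.exp_ne_zero _)
  have hre := congrArg Complex.re h3
  have him := congrArg Complex.im h3
  simp only [Complex.add_re, Complex.add_im, Complex.ofReal_re, Complex.ofReal_im,
    Complex.re_ofReal_mul, Complex.im_ofReal_mul, Complex.I_re, Complex.I_im] at hre him
  exact ⟨by simpa using hre, by simpa using him⟩

namespace PolyhedronPresentation

variable {n m : ℕ} (P : PolyhedronPresentation n m)

/-! ### The map `N_P → ℂᵐ` is an immersion -/

/-- The derivative of `quadrics` at `u` sends `v` to the projection onto `K` of `(2 * u k * v k)_k`.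
The hypothesis makes `τ` orthogonal to its image, which is all of `K` by genericity. -/
theorem eq_zero_of_mem_relations [P.IsGeneric] {u : EuclideanSpace ℝ (Fin m)}
    (hu : u ∈ P.realMomentAngle) (τ : P.relations) (h : ∀ k, u k * τ.1 k = 0) : τ = 0 := by
  obtain ⟨v, hv⟩ := P.quadrics_fderiv_surjective hu τ
  rw [← inner_self_eq_zero (𝕜 := ℝ)]
  nth_rw 1 [← hv]
  change inner ℝ (P.relations.orthogonalProjectionOnto (doubleMul u v)) τ = 0
  rw [Submodule.inner_orthogonalProjectionOnto_eq_of_mem_right, PiLp.inner_apply]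
  refine Finset.sum_eq_zero fun k _ => ?_
  change τ.1 k * (2 * u k * v k) = 0
  linear_combination 2 * v k * h k

/-! ### The map in straightening coordinates and its derivative. -/

variable {P} {Φ : OpenPartialHomeomorph (EuclideanSpace ℝ (Fin m))
  (P.relations × EuclideanSpace ℝ (Fin n))}

variable (Φ) in
/-- The map `N_P → ℂᵐ` in the coordinates on `N_P` induced by straightening coordinates. -/
noncomputable def localMap (p : EuclideanSpace ℝ (Fin n) × P.relations) :
    EuclideanSpace ℂ (Fin m) :=
  WithLp.toLp 2 fun k => (Φ.symm (0, p.1) k : ℂ) * (torusExp p.2.1 k : ℂ)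

theorem isOpen_slice : IsOpen {w | ((0 : P.relations), w) ∈ Φ.target} :=
  Φ.open_target.preimage (by fun_prop)

theorem IsStraightening.contDiffOn_slice (hΦ : P.IsStraightening Φ) :
    ContDiffOn ℝ ∞ (fun w => Φ.symm ((0 : P.relations), w))
      {w | ((0 : P.relations), w) ∈ Φ.target} :=
  (hΦ.contDiffOn_symm.of_le (by simp)).comp (by fun_prop) fun _ hw => hw

theorem IsStraightening.contDiffOn_localMap (hΦ : P.IsStraightening Φ) :
    ContDiffOn ℝ ∞ (localMap Φ) {p | ((0 : P.relations), p.1) ∈ Φ.target} := by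
  refine (PiLp.contDiff_toLp).comp_contDiffOn (contDiffOn_pi.2 fun k => ?_)
  have h1 : ContDiffOn ℝ ∞ (fun p : EuclideanSpace ℝ (Fin n) × P.relations =>
      Φ.symm ((0 : P.relations), p.1) k) {p | ((0 : P.relations), p.1) ∈ Φ.target} :=
    (EuclideanSpace.proj k : EuclideanSpace ℝ (Fin m) →L[ℝ] ℝ).contDiff.comp_contDiffOn
      (hΦ.contDiffOn_slice.comp contDiff_fst.contDiffOn fun _ hp => hp)
  have h2 : ContDiff ℝ ∞ fun p : EuclideanSpace ℝ (Fin n) × P.relations => p.2.1 k :=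
    ((EuclideanSpace.proj k : EuclideanSpace ℝ (Fin m) →L[ℝ] ℝ) ∘L
      P.relations.subtypeL).contDiff.comp contDiff_snd
  have h3 : ContDiff ℝ ∞ fun p : EuclideanSpace ℝ (Fin n) × P.relations =>
      (torusExp p.2.1 k : ℂ) := by
    simp only [torusExp, Circle.coe_exp]
    exact ((Complex.ofRealCLM.contDiff.comp (contDiff_const.mul h2)).mul contDiff_const).cexp
  exact (Complex.ofRealCLM.contDiff.comp_contDiffOn h1).mul h3.contDiffOn

/-- Along the line through `p` in a kernel direction `(v, τ)`, each coordinate is a real function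
times a circle-valued one, so `hasDerivAt_zero_of_mul_circleExp` splits it. The angular part gives
`τ = 0` by `eq_zero_of_mem_relations`; the radial part gives `v = 0` since the slice parametrization
is an immersion. -/
theorem IsStraightening.fderiv_localMap_injective [P.IsGeneric] (hΦ : P.IsStraightening Φ)
    {p : EuclideanSpace ℝ (Fin n) × P.relations} (hp : ((0 : P.relations), p.1) ∈ Φ.target) :
    Function.Injective (fderiv ℝ (localMap Φ) p) := by
  rw [injective_iff_map_eq_zero]
  rintro ⟨v, τ⟩ hd
  have hopen : IsOpen {p : EuclideanSpace ℝ (Fin n) × P.relations |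
      ((0 : P.relations), p.1) ∈ Φ.target} := Φ.open_target.preimage (by fun_prop)
  have hF := ((hΦ.contDiffOn_localMap.contDiffAt (hopen.mem_nhds hp)).differentiableAt
    (by simp)).hasFDerivAt
  have hs := ((hΦ.contDiffOn_slice.contDiffAt (isOpen_slice.mem_nhds hp)).differentiableAt
    (by simp)).hasFDerivAt
  set s' := fderiv ℝ (fun w => Φ.symm ((0 : P.relations), w)) p.1
  have hline : HasDerivAt (fun t : ℝ => p + t • (v, τ)) (v, τ) 0 := by
    simpa using ((hasDerivAt_id (0 : ℝ)).smul_const (v, τ)).const_add p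
  have hline1 : HasDerivAt (fun t : ℝ => p.1 + t • v) v 0 := by
    simpa using ((hasDerivAt_id (0 : ℝ)).smul_const v).const_add p.1
  have hs1 : HasDerivAt (fun t : ℝ => Φ.symm ((0 : P.relations), p.1 + t • v)) (s' v) 0 :=
    HasFDerivAt.comp_hasDerivAt (l := fun w => Φ.symm ((0 : P.relations), w))
      (f := fun t : ℝ => p.1 + t • v) 0 (by simpa using hs) hline1
  have hF1 : HasDerivAt (fun t : ℝ => localMap Φ (p + t • (v, τ))) 0 0 := by
    have := HasFDerivAt.comp_hasDerivAt (f := fun t : ℝ => p + t • (v, τ)) 0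
      (by simpa using hF) hline
    rwa [hd] at this
  have hk : ∀ k, s' v k = 0 ∧ Φ.symm ((0 : P.relations), p.1) k * τ.1 k = 0 := by
    intro k
    have ha : HasDerivAt (fun t : ℝ => Φ.symm ((0 : P.relations), p.1 + t • v) k) (s' v k) 0 :=
      (EuclideanSpace.proj k : EuclideanSpace ℝ (Fin m) →L[ℝ] ℝ).hasFDerivAt.comp_hasDerivAt
        (0 : ℝ) hs1
    have hb : HasDerivAt (fun t : ℝ => 2 * Real.pi * (p.2.1 k + t * τ.1 k))
        (2 * Real.pi * τ.1 k) 0 := by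
      simpa using (((hasDerivAt_id (0 : ℝ)).mul_const (τ.1 k)).const_add
        (p.2.1 k)).const_mul (2 * Real.pi)
    have hc : HasDerivAt (fun t : ℝ => localMap Φ (p + t • (v, τ)) k) 0 0 := by
      have := ((EuclideanSpace.proj k : EuclideanSpace ℂ (Fin m) →L[ℂ] ℂ).restrictScalars
        ℝ).hasFDerivAt.comp_hasDerivAt (0 : ℝ) hF1
      rw [map_zero] at this
      exact this
    obtain ⟨h1, h2⟩ := hasDerivAt_zero_of_mul_circleExp ha hb hc
    refine ⟨h1, ?_⟩
    rw [zero_smul, add_zero] at h2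
    have := Real.pi_ne_zero
    have h3 : (2 * Real.pi) * (Φ.symm ((0 : P.relations), p.1) k * τ.1 k) = 0 := by linarith
    simpa [this] using h3
  have hmem : Φ.symm ((0 : P.relations), p.1) ∈ P.realMomentAngle := by
    rw [mem_realMomentAngle_iff, ← hΦ.fst_eq _ (Φ.map_target hp), Φ.right_inv hp]
  have hτ := P.eq_zero_of_mem_relations hmem τ fun k => (hk k).2
  have hs0 : s' v = 0 := by
    ext k
    exact (hk k).1
  -- The second component of `Φ` is a differentiable left inverse of `w ↦ Φ.symm (0, w)`, so `s' v =
  -- 0` forces `v = 0`.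
  have hΦ1 : DifferentiableAt ℝ (fun u => (Φ u).2) (Φ.symm ((0 : P.relations), p.1)) :=
    differentiableAt_snd.comp _ ((hΦ.contDiffOn.contDiffAt
      (Φ.open_source.mem_nhds (Φ.map_target hp))).differentiableAt (by simp))
  have h1 := HasFDerivAt.comp_hasDerivAt
    (f := fun t : ℝ => Φ.symm ((0 : P.relations), p.1 + t • v)) 0
    (by simpa using hΦ1.hasFDerivAt) hs1
  rw [hs0, map_zero] at h1
  have hev : ∀ᶠ t : ℝ in 𝓝 0, (0, p.1 + t • v) ∈ Φ.target :=
    hline1.continuousAt.eventually (isOpen_slice.mem_nhds (by simpa using hp))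
  have hv : v = 0 := by
    refine hline1.unique (h1.congr_of_eventuallyEq ?_)
    filter_upwards [hev] with t ht
    simp [Φ.right_inv ht]
  rw [hv, hτ]
  rfl

/-- The charts of `N_P` and `T_P` are built from local inverses of covering maps, so their inverses
are the covering maps themselves. An inverse chart thus sends `(w, χ)` to the class of the slice
point over `w` paired with the exponential of `χ`. -/
theorem quotientMap_comp_chart_symm [P.IsGeneric] [P.IsRational] (y : P.quotientSpace) :
    ∃ Φ, P.IsStraightening Φ ∧
      Set.EqOn (P.quotientMap ∘ ((chartAt (ModelProd (EuclideanSpace ℝ (Fin n)) P.relations)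
        y).extend P.model).symm) (localMap Φ) {p | ((0 : P.relations), p.1) ∈ Φ.target} ∧
      ((chartAt (ModelProd (EuclideanSpace ℝ (Fin n)) P.relations) y).extend P.model).target ⊆
        {p | ((0 : P.relations), p.1) ∈ Φ.target} := by
  let hl := (isQuotientCoveringMap_quotientMk_of_properlyDiscontinuousSMul (G := P.signGroup)
    (E := P.realMomentAngle × P.torus)).isCoveringMap.isLocalHomeomorph
  let q : P.realMomentAngle × P.torus := (Quotient.mk_surjective
    (s := MulAction.orbitRel P.signGroup (P.realMomentAngle × P.torus))).hasRightInverse.choose y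
  have hch : chartAt (ModelProd (EuclideanSpace ℝ (Fin n)) P.relations) y =
    (hl.localInverseAt q).trans (chartAt _ q) := rfl
  obtain ⟨hΦ, -⟩ := P.straightening_spec q.1
  refine ⟨P.straightening q.1, hΦ, fun p hp => ?_, fun p hp => ?_⟩
  · have hp' : ((0 : P.relations), p.1) ∈ (P.straightening q.1).target := hp
    have h1 : ((P.sliceChart q.1 _ hΦ).symm p.1).1 = (P.straightening q.1).symm (0, p.1) := by
      simp [sliceChart, hp']
    let q' : P.torus → P.relations :=
      (P.relationsExp_surjective).hasRightInverse.choose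
    -- The chart of the vector space `K` is the identity, so only the covering map remains.
    have h2 : (chartAt P.relations q.2).symm p.2 = P.relationsExp p.2 := by
      have : chartAt P.relations q.2 = (P.relationsExp_isLocalHomeomorph.localInverseAt
        (q' q.2)).trans (chartAt P.relations (q' q.2)) := rfl
      rw [this]
      change (P.relationsExp_isLocalHomeomorph.localInverseAt _).symm _ = _
      rw [P.relationsExp_isLocalHomeomorph.localInverseAt_symm]
      rfl
    have h3 : ((chartAt (ModelProd (EuclideanSpace ℝ (Fin n)) P.relations) y).extend
        P.model).symm p = Quotient.mk _ ((P.sliceChart q.1 _ hΦ).symm p.1, P.relationsExp p.2) := by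
      rw [← h2, hch]
      change (hl.localInverseAt q).symm _ = _
      rw [hl.localInverseAt_symm]
      rfl
    rw [Function.comp_apply, h3]
    ext k
    change (((P.sliceChart q.1 _ hΦ).symm p.1).1 k : ℂ) * _ = _
    rw [h1]
    rfl
  · exact hp.2.1.1

/-- No Delzant condition enters: linear independence of the active normals already makes the
derivative injective. The complement has dimension `m`, the codimension of the `m`-dimensional `N_P`
in `ℂᵐ`. -/
theorem isImmersionOfComplement_quotientMap [P.IsGeneric] [P.IsRational] :
    Manifold.IsImmersionOfComplement (EuclideanSpace ℝ (Fin m)) P.model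
      𝓘(ℝ, EuclideanSpace ℂ (Fin m)) ∞ P.quotientMap := by
  intro y
  obtain ⟨Φ, hΦ, heq, hsub⟩ := quotientMap_comp_chart_symm y
  set φ := chartAt (ModelProd (EuclideanSpace ℝ (Fin n)) P.relations) y
  have hy : y ∈ φ.source := mem_chart_source _ y
  have hyt : φ.extend P.model y ∈ (φ.extend P.model).target :=
    (φ.extend P.model).map_source (by rwa [φ.extend_source])
  have hopen : IsOpen {p : EuclideanSpace ℝ (Fin n) × P.relations |
      ((0 : P.relations), p.1) ∈ Φ.target} := Φ.open_target.preimage (by fun_prop)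
  refine Manifold.isImmersionAtOfComplement_of_fderiv_injective
    (IsManifold.chart_mem_maximalAtlas y) hy ((hΦ.contDiffOn_localMap.congr heq).mono hsub) ?_ ?_
  · rw [(heq.eventuallyEq_of_mem (hopen.mem_nhds (hsub hyt))).fderiv_eq]
    exact hΦ.fderiv_localMap_injective (hsub hyt)
  · have h1 := P.finrank_relations
    have h2 : Module.finrank ℝ (EuclideanSpace ℂ (Fin m)) = 2 * m := by
      rw [← Module.finrank_mul_finrank ℝ ℂ (EuclideanSpace ℂ (Fin m)),
        Complex.finrank_real_complex, finrank_euclideanSpace_fin]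
    rw [h2, Module.finrank_prod, finrank_euclideanSpace_fin, finrank_euclideanSpace_fin]
    omega

end PolyhedronPresentation

/-! ### The equivalence with the Delzant condition. -/

theorem theorem4p6 {n m : ℕ} (P : PolyhedronPresentation n m) [P.IsGeneric] [P.IsRational] :
    Manifold.IsSmoothEmbedding P.model 𝓘(ℝ, EuclideanSpace ℂ (Fin m)) ∞ P.quotientMap ↔
      P.IsDelzant := by
  refine ⟨fun h => ?_, fun h => ?_⟩
  · exact (P.hasTrivialStabilizers_of_injective h.isEmbedding.injective).isDelzant
  · exact ⟨PolyhedronPresentation.isImmersionOfComplement_quotientMap.isImmersion,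
      P.isEmbedding_quotientMap h.hasTrivialStabilizers.quotientMap_injective⟩
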